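/- **Setting.** Fix $r\ge 1$, an integer $\bar m\ge 2$, $\nu>0$ and $\sigma\in\mathbb R$. For each $n$ let $p=p_n$ with $p\to\infty$, and let $$\boldsymbol x_i=\boldsymbol\eta(\boldsymbol\alpha_i)+\boldsymbol u_i\in\mathbb R^p,\qquad \mathbb E[\boldsymbol u_i\mid\mathscr F]=0,\qquad i=1,\dots,n,$$ where $\boldsymbol\alpha_i\in\mathbb R^r$ are random vectors, $\boldsymbol\eta=(\eta_1,\dots,\eta_p)'$ is a random function on $\mathbb R^r$, and $\mathscr F$ is the $\sigma$-field generated by $(\boldsymbol\alpha_i)_{i\le n}$ and $\boldsymbol\eta$. Write $\boldsymbol X=\boldsymbol H+\boldsymbol U$ for the $p\times n$ matrices with columns $\boldsymbol x_i$, $\boldsymbol\eta(\boldsymbol\alpha_i)$, $\boldsymbol u_i$. The row set is split as $[p]=\mathcal R^\dagger\cup\mathcal R^\ddagger$ (disjoint), with $p^\dagger=|\mathcal R^\dagger|\asymp p$ and $p^\ddagger=|\mathcal R^\ddagger|\asymp p$; a superscript $\dagger$ denotes restriction to the rows in $\mathcal R^\dagger$. For $\boldsymbol v,\boldsymbol w\in\mathbb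 R^{p^\dagger}$ let $\rho(\boldsymbol v,\boldsymbol w)=\frac1{p^\dagger}\|\boldsymbol v-\boldsymbol w\|^2$. All limits are as $n\to\infty$. For random sequences, $Y_n\lesssim_{\mathbb P}b_n$ (also written $Y_n=O_{\mathbb P}(b_n)$) means $\limsup_{\varepsilon\to\infty}\limsup_n\mathbb P[|Y_n/b_n|\ge\varepsilon]=0$, where a nonzero $Y_n$ over $b_n=0$ counts as infinite, and $Y_n\gtrsim_{\mathbb P}1$ means $1\lesssim_{\mathbb P}Y_n$. **Regularity conditions.** (a) For each $n$, $\boldsymbol\alpha_1,\dots,\boldsymbol\alpha_n$ are i.i.d. on a fixed compact convex support $\mathcal A\subset\mathbb R^r$, with a Lebesgue density on $\mathcal A$ that is bounded and bounded away from zero (uniformly in $n$). (b) Almost surely each $\eta_l$ is $\bar m$ times continuously differentiable on $\mathcal A$ (derivatives at the boundary being taken within $\mathcal A$), and all its partial derivatives of order at most $\bar m$ are bounded on $\mathcal A$ by a universal constant. (c) The $u_{il}$ ($i\le n$, $l\le p$) are independent over $i$ and $l$ conditionally on $\mathscr F$, and $\max_{i\le n,\,l\le p}\mathbb E[|u_{il}|^{2+\nu}\mid\mathscr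 F]=O_{\mathbb P}(1)$. **Theorem (Euclidean distance).** Suppose moreover that 1. $\frac1{p^\dagger}\sum_{l\in\mathcal R^\dagger}\mathbb E[u_{il}^2\mid\mathscr F]=\sigma^2$ almost surely, for all $i\in[n]$ and all $n$; 2. $\max_{i\in[n],\,l\in\mathcal R^\dagger}\mathbb E[|u_{il}|^{4+2\nu}\mid\mathscr F]=O_{\mathbb P}(1)$; 3. for every $\varepsilon>0$, $\displaystyle\lim_{\Delta\downarrow0}\limsup_{n\to\infty}\mathbb P\Big\{\max_{i\in[n]}\ \max_{j:\rho(\boldsymbol H^\dagger_{\cdot i},\boldsymbol H^\dagger_{\cdot j})<\Delta}\|\boldsymbol\alpha_i-\boldsymbol\alpha_j\|>\varepsilon\Big\}=0$; 4. for some $\underline c>0$, $\displaystyle\lim_{n\to\infty}\mathbb P\Big\{\min_{i\in[n]}s_{\min}\Big(\tfrac1{p^\dagger}\nabla\boldsymbol\eta^\dagger(\boldsymbol\alpha_i)'\,\nabla\boldsymbol\eta^\dagger(\boldsymbol\alpha_i)\Big)\ge\underline c\Big\}=1$, where $s_{\min}$ is the smallest singular value and $\nabla\boldsymbol\eta^\dagger$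 the $p^\dagger\times r$ Jacobian matrix; 5. $n^{4/\nu}(\log n)^{(\nu-2)/\nu}/p=O(1)$. Then the indirect-matching conditions hold with $a_n=((\log n)/p)^{1/4}$, $\rho_0=2\sigma^2$ and $\underline\varsigma=\bar\varsigma=2$. That is, $\rho_0\ge 0$, $a_n>0$ for all large $n$, $a_n\to0$, and $$\max_{1\le i\ne j\le n}\big|\rho(\boldsymbol X^\dagger_{\cdot i},\boldsymbol X^\dagger_{\cdot j})-\rho(\boldsymbol H^\dagger_{\cdot i},\boldsymbol H^\dagger_{\cdot j})-\rho_0\big|\lesssim_{\mathbb P}a_n,$$ $$\max_{i,j\le n:\ \boldsymbol\alpha_i\ne\boldsymbol\alpha_j}\frac{\rho(\boldsymbol H^\dagger_{\cdot i},\boldsymbol H^\dagger_{\cdot j})}{\|\boldsymbol\alpha_i-\boldsymbol\alpha_j\|^{\bar\varsigma}}\lesssim_{\mathbb P}1,\qquad \min_{i,j\le n:\ \boldsymbol\alpha_i\ne\boldsymbol\alpha_j}\frac{\rho(\boldsymbol H^\dagger_{\cdot i},\boldsymbol H^\dagger_{\cdot j})}{\|\boldsymbol\alpha_i-\boldsymbol\alpha_j\|^{\underline\varsigma}}\gtrsim_{\mathbb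 P}1.$$ -/

import Mathlib

open MeasureTheory ProbabilityTheory Filter Topology Asymptotics
open scoped ENNReal

noncomputable section

namespace NonlinearFactor

/-- `a ≍ b`, `a ≲ b` for deterministic sequences are `a =Θ[atTop] b`, `a =O[atTop] b`.
`BigOP μ Y b` is `Y ≲_P b`, i.e.
`limsup_{ε → ∞} limsup_n P(|Y_n / b_n| ≥ ε) = 0`.
The event is written as `ε |b_n| ≤ |Y_n|`, so that a vanishing denominator counts as an infinite
ratio; `b` may itself be random. -/
def BigOP {Ω : ℕ → Type*} [∀ n, MeasurableSpace (Ω n)] (μ : ∀ n, Measure (Ω n))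
    (Y b : ∀ n, Ω n → ℝ) : Prop :=
  limsup (fun ε : ℝ => limsup (fun n : ℕ => μ n {ω | ε * |b n ω| ≤ |Y n ω|}) atTop) atTop = 0

/-- `Y = O_P(1)` for random variables with values in `[0, ∞]`. -/
def StochBounded {Ω : ℕ → Type*} [∀ n, MeasurableSpace (Ω n)] (μ : ∀ n, Measure (Ω n))
    (Y : ∀ n, Ω n → ℝ≥0∞) : Prop :=
  limsup (fun ε : ℝ => limsup (fun n : ℕ => μ n {ω | ENNReal.ofReal ε ≤ Y n ω}) atTop) atTop = 0

/-- Conditional independence, given the σ-field `m`, of a family of real random variables: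
conditional probabilities of finite intersections factorize almost surely.
On standard Borel spaces this is Mathlib's `iCondIndepFun`, see `condIndepFamily_iff`. -/
def CondIndepFamily {Ω ι : Type*} (m : MeasurableSpace Ω) [MeasurableSpace Ω]
    (μ : Measure Ω) (Z : ι → Ω → ℝ) : Prop :=
  ∀ (s : Finset ι) (B : ι → Set ℝ), (∀ i ∈ s, MeasurableSet (B i)) →
    μ⟦⋂ i ∈ s, Z i ⁻¹' B i | m⟧ =ᵐ[μ] ∏ i ∈ s, μ⟦Z i ⁻¹' B i | m⟧

theorem condIndepFamily_iff {Ω ι : Type*} (m : MeasurableSpace Ω) [mΩ : MeasurableSpace Ω]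
    [StandardBorelSpace Ω] (hm : m ≤ mΩ) (μ : Measure Ω) [IsFiniteMeasure μ] (Z : ι → Ω → ℝ)
    (hZ : ∀ i, Measurable (Z i)) :
    CondIndepFamily m μ Z ↔ iCondIndepFun m hm Z (μ := μ) := by
  refine Iff.trans ?_
    (iCondIndepFun_iff_condExp_inter_preimage_eq_mul (hm' := hm) (μ := μ) _ Z hZ).symm
  exact ⟨fun h s B hB => h s B hB, fun h s B hB => h s hB⟩

/-- Smallest singular value of a real `r × r` matrix.  (Mathlib's singular values are indexed from
zero in decreasing order.) -/
def sMin {r : ℕ} (M : Matrix (Fin r) (Fin r) ℝ) : ℝ :=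
  (Matrix.toEuclideanLin M).singularValues (r - 1)

/-- The squared Euclidean distance `ρ(v, w) = ‖v - w‖² / d` of `d`-vectors. -/
def sqDist {ι : Type*} [Fintype ι] (v w : EuclideanSpace ℝ ι) : ℝ :=
  ‖v - w‖ ^ 2 / (Fintype.card ι : ℝ)

/-- The random elements of a nonlinear factor model with `n` units, `p` features and latent
variables in `ℝ^r`: latent variables `α i`, random latent functions `η l` and errors `u i l`. -/
structure Sample (r n p : ℕ) (Ω : Type*) [MeasurableSpace Ω] where
  α : Fin n → Ω → EuclideanSpace ℝ (Fin r)
  η : Fin p → Ω → EuclideanSpace ℝ (Fin r) → ℝ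
  u : Fin n → Fin p → Ω → ℝ
  measurable_α : ∀ i, Measurable (α i)
  measurable_η : ∀ l x, Measurable fun ω => η l ω x
  measurable_u : ∀ i l, Measurable (u i l)

namespace Sample

variable {r n p : ℕ} {Ω : Type*} [mΩ : MeasurableSpace Ω] (S : Sample r n p Ω)

/-- The σ-field `ℱ` generated by the latent variables and the latent functions. -/
@[reducible] def latentField : MeasurableSpace Ω :=
  (⨆ i, MeasurableSpace.comap (S.α i) inferInstance) ⊔
    ⨆ l, ⨆ x, MeasurableSpace.comap (fun ω => S.η l ω x) inferInstance

theorem latentField_le : S.latentField ≤ mΩ :=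
  sup_le (iSup_le fun i => (S.measurable_α i).comap_le)
    (iSup_le fun l => iSup_le fun x => (S.measurable_η l x).comap_le)

/-- `E[|u_il|^q | ℱ]`, as a conditional expectation with values in `[0, ∞]`. -/
def condMoment (μ : Measure Ω) (q : ℝ) (i : Fin n) (l : Fin p) : Ω → ℝ≥0∞ :=
  condLExp S.latentField μ fun ω => ENNReal.ofReal (|S.u i l ω| ^ q)

/-- Column `i` of the submatrix `H^†` of `H = (η_l(α_i))` with rows in `R`. -/
def colH (R : Finset (Fin p)) (i : Fin n) (ω : Ω) : EuclideanSpace ℝ R :=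
  WithLp.toLp 2 fun l => S.η l ω (S.α i ω)

/-- Column `i` of the submatrix `X^†` of `X = H + U` with rows in `R`. -/
def colX (R : Finset (Fin p)) (i : Fin n) (ω : Ω) : EuclideanSpace ℝ R :=
  WithLp.toLp 2 fun l => S.η l ω (S.α i ω) + S.u i l ω

/-- The Jacobian `∇η^†(x)`, with derivatives taken within the support `A`. -/
def jacobian (A : Set (EuclideanSpace ℝ (Fin r))) (R : Finset (Fin p)) (ω : Ω)
    (x : EuclideanSpace ℝ (Fin r)) : Matrix R (Fin r) ℝ :=
  Matrix.of fun l k => fderivWithin ℝ (S.η l ω) A x (EuclideanSpace.single k 1)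

/-- The normalized Gram matrix `∇η^†(x)' ∇η^†(x) / p^†`. -/
def gram (A : Set (EuclideanSpace ℝ (Fin r))) (R : Finset (Fin p)) (ω : Ω)
    (x : EuclideanSpace ℝ (Fin r)) : Matrix (Fin r) (Fin r) ℝ :=
  (1 / (R.card : ℝ)) • ((S.jacobian A R ω x).transpose * S.jacobian A R ω x)

end Sample

/-- The regularity conditions on a sequence of nonlinear factor models, including `E[u | ℱ] = 0`. -/
structure Regularities {r : ℕ} {p : ℕ → ℕ} {Ω : ℕ → Type*} [∀ n, MeasurableSpace (Ω n)]
    (μ : ∀ n, Measure (Ω n)) (S : ∀ n, Sample r n (p n) (Ω n))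
    (A : Set (EuclideanSpace ℝ (Fin r))) (m : ℕ) (ν : ℝ) : Prop where
  /-- The errors are integrable and have conditional mean zero. -/
  integrable_u : ∀ n i l, Integrable ((S n).u i l) (μ n)
  condMean_u : ∀ n i l, (μ n)[(S n).u i l | (S n).latentField] =ᵐ[μ n] 0
  /-- The latent variables are i.i.d. with a density on the compact convex support `A` that is
  bounded and bounded away from zero. -/
  isCompact : IsCompact A
  convex : Convex ℝ A
  indep_α : ∀ n, iIndepFun (S n).α (μ n)
  density_α : ∃ c C : ℝ, 0 < c ∧ ∀ n, ∃ f : EuclideanSpace ℝ (Fin r) → ℝ, Measurable f ∧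
    (∀ x ∈ A, c ≤ f x ∧ f x ≤ C) ∧
    ∀ i, (μ n).map ((S n).α i) = (volume.restrict A).withDensity fun x => ENNReal.ofReal (f x)
  /-- The latent functions are `m` times continuously differentiable on `A`, and all their partial
  derivatives of order at most `m` are bounded by a universal constant. -/
  smooth : ∀ n, ∀ᵐ ω ∂μ n, ∀ l, ContDiffOn ℝ m ((S n).η l ω) A
  bounded : ∃ C : ℝ, ∀ n, ∀ᵐ ω ∂μ n, ∀ l, ∀ k ≤ m, ∀ d : Fin k → Fin r, ∀ x ∈ A,
    |iteratedFDerivWithin ℝ k ((S n).η l ω) A x fun s => EuclideanSpace.single (d s) 1| ≤ C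
  /-- The errors are independent over `i` and `l` conditionally on `ℱ`, with conditional moments of
  order `2 + ν` that are bounded in probability uniformly over `i` and `l`. -/
  condIndep_u : ∀ n, CondIndepFamily (S n).latentField (μ n)
    fun q : Fin n × Fin (p n) => (S n).u q.1 q.2
  moment_u : StochBounded μ fun n ω => ⨆ i, ⨆ l, (S n).condMoment (μ n) (2 + ν) i l ω

/-- Indirect matching for the rows `R n` and the distance `ρ n`, with constants `ρ₀`, `ςlo`
(lower bound), `ςhi` (upper bound) and rate `a`. -/
structure IndirectMatching {r : ℕ} {p : ℕ → ℕ} {Ω : ℕ → Type*} [∀ n, MeasurableSpace (Ω n)]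
    (μ : ∀ n, Measure (Ω n)) (S : ∀ n, Sample r n (p n) (Ω n)) (R : ∀ n, Finset (Fin (p n)))
    (ρ : ∀ n, EuclideanSpace ℝ (R n) → EuclideanSpace ℝ (R n) → ℝ)
    (ρ₀ ςlo ςhi : ℝ) (a : ℕ → ℝ) : Prop where
  ρ₀_nonneg : 0 ≤ ρ₀
  ςlo_pos : 0 < ςlo
  ςhi_pos : 0 < ςhi
  a_pos : ∀ᶠ n in atTop, 0 < a n
  a_tendsto : Tendsto a atTop (𝓝 0)
  /-- `max_{i ≠ j} |ρ(X_i, X_j) - ρ(H_i, H_j) - ρ₀| ≲_P a_n`. -/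
  denoising : BigOP μ
    (fun n ω => ⨆ q : {q : Fin n × Fin n // q.1 ≠ q.2},
      |ρ n ((S n).colX (R n) q.1.1 ω) ((S n).colX (R n) q.1.2 ω)
        - ρ n ((S n).colH (R n) q.1.1 ω) ((S n).colH (R n) q.1.2 ω) - ρ₀|)
    (fun n _ => a n)
  /-- `max_{α_i ≠ α_j} ρ(H_i, H_j) / ‖α_i - α_j‖ ^ ςhi ≲_P 1`. -/
  upper : BigOP μ
    (fun n ω => ⨆ q : {q : Fin n × Fin n // (S n).α q.1 ω ≠ (S n).α q.2 ω},
      ρ n ((S n).colH (R n) q.1.1 ω) ((S n).colH (R n) q.1.2 ω)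
        / ‖(S n).α q.1.1 ω - (S n).α q.1.2 ω‖ ^ ςhi)
    (fun _ _ => 1)
  /-- `1 ≲_P min_{α_i ≠ α_j} ρ(H_i, H_j) / ‖α_i - α_j‖ ^ ςlo`. -/
  lower : BigOP μ (fun _ _ => 1)
    (fun n ω => ⨅ q : {q : Fin n × Fin n // (S n).α q.1 ω ≠ (S n).α q.2 ω},
      ρ n ((S n).colH (R n) q.1.1 ω) ((S n).colH (R n) q.1.2 ω)
        / ‖(S n).α q.1.1 ω - (S n).α q.1.2 ω‖ ^ ςlo)

end NonlinearFactor

end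

/-!
Write `h = H_i - H_j` for a pair of columns. Expanding the square, the `l`-th term of
`p^† (ρ(X_i, X_j) - ρ(H_i, H_j))` is `u_il² + u_jl² - 2 ((u_il + h_l) (u_jl - h_l) + h_l²)`.
Given the latent field, `h` is a bounded constant and the shifted errors `u_il + h_l` and
`u_jl - h_l` are independent with product of mean `-h_l²`, so each of the three sums over `l` is,
after subtracting `p^† σ²` from the first two, a sum of independent centered variables. A moment
inequality of order `q` for such sums gives tails of order `(p a_n²) ^ (-q / 2)`. The squares
`u_il²` have conditional moments of order `2 + ν`, which beats a union bound over `n` indices. The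
products factor into independent variables, so they have moments of the full order `4 + 2ν`, which
beats a union bound over `n²` pairs; the rate condition says `n (p a_n²) ^ (-(2 + ν) / 2) → 0`.

The upper bound on `ρ(H_i, H_j) / ‖α_i - α_j‖²` is the Lipschitz estimate for `η`. For the lower
bound, pairs whose latent variables are within a small fixed distance are treated by the
second-order Taylor expansion of `η` and the lower bound on the Gram matrix; the other pairs have
`ρ(H_i, H_j)` bounded below by the separation condition, and `‖α_i - α_j‖` bounded above by the
diameter of the support.
-/

namespace NonlinearFactor

section PointwiseInequalities

variable {q s x y a b : ℝ}

theorem rpow_add_mul_sub_le_rpow (hq : 1 ≤ q) (hx : 0 ≤ x) (hy : 0 ≤ y) :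
    x ^ q + q * x ^ (q - 1) * (y - x) ≤ y ^ q := by
  rcases hx.eq_or_lt with rfl | hx
  · rcases hq.eq_or_lt with rfl | hq
    · simp
    · simpa [Real.zero_rpow (by linarith : q ≠ 0), Real.zero_rpow (by linarith : q - 1 ≠ 0)]
        using Real.rpow_nonneg hy q
  · have bernoulli : 1 + q * (y / x - 1) ≤ (y / x) ^ q := by
      simpa using one_add_mul_self_le_rpow_one_add (s := y / x - 1)
        (by linarith [div_nonneg hy hx.le]) hq
    rw [Real.div_rpow hy hx.le, le_div_iff₀ (Real.rpow_pos_of_pos hx q)] at bernoulli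
    refine le_of_eq_of_le ?_ bernoulli
    rw [Real.rpow_sub_one hx.ne']
    field_simp

theorem abs_rpow_add_mul_sub_le_abs_rpow (hq : 1 ≤ q) :
    |x| ^ q + q * (x * |x| ^ (q - 2)) * (y - x) ≤ |y| ^ q := by
  rcases eq_or_ne x 0 with rfl | hx
  · simpa [Real.zero_rpow (by linarith : q ≠ 0)] using Real.rpow_nonneg (abs_nonneg y) q
  · have pow_eq : |x| ^ (q - 1) = |x| * |x| ^ (q - 2) := by
      rw [show q - 1 = 1 + (q - 2) by ring, Real.rpow_add (abs_pos.2 hx), Real.rpow_one]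
    have slope_le : x * (y - x) ≤ |x| * (|y| - |x|) := by
      nlinarith [le_abs_self (x * y), abs_mul x y, abs_mul_abs_self x]
    calc |x| ^ q + q * (x * |x| ^ (q - 2)) * (y - x)
        = |x| ^ q + q * |x| ^ (q - 2) * (x * (y - x)) := by ring
      _ ≤ |x| ^ q + q * |x| ^ (q - 2) * (|x| * (|y| - |x|)) := by gcongr
      _ = |x| ^ q + q * |x| ^ (q - 1) * (|y| - |x|) := by rw [pow_eq]; ring
      _ ≤ |y| ^ q := rpow_add_mul_sub_le_rpow hq (abs_nonneg x) (abs_nonneg y)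

theorem abs_mul_abs_rpow_sub_mul_abs_rpow_le (hs : 0 ≤ s) :
    |x * |x| ^ s - y * |y| ^ s| ≤ (s + 1) * max |x| |y| ^ s * |x - y| := by
  wlog hyx : |y| ≤ |x| generalizing x y
  · simpa only [abs_sub_comm, max_comm] using this (le_of_not_ge hyx)
  rw [max_eq_left hyx]
  have pow_le : |y| ^ s ≤ |x| ^ s := Real.rpow_le_rpow (abs_nonneg y) hyx hs
  have mul_sub_pow_le : |y| * (|x| ^ s - |y| ^ s) ≤ s * |x| ^ s * |x - y| := by
    have tangent := rpow_add_mul_sub_le_rpow (q := s + 1) (by linarith) (abs_nonneg x)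
      (abs_nonneg y)
    rw [Real.rpow_add_one' (abs_nonneg x) (by linarith),
      Real.rpow_add_one' (abs_nonneg y) (by linarith), add_sub_cancel_right] at tangent
    have := mul_le_mul_of_nonneg_left (abs_sub_abs_le_abs_sub x y)
      (mul_nonneg hs (Real.rpow_nonneg (abs_nonneg x) s))
    linarith
  calc |x * |x| ^ s - y * |y| ^ s|
      = |(x - y) * |x| ^ s + y * (|x| ^ s - |y| ^ s)| := by ring_nf
    _ ≤ |x - y| * |x| ^ s + |y| * (|x| ^ s - |y| ^ s) := by
        refine (abs_add_le _ _).trans_eq ?_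
        rw [abs_mul, abs_mul, abs_of_nonneg (sub_nonneg.2 pow_le),
          abs_of_nonneg (Real.rpow_nonneg (abs_nonneg x) s)]
    _ ≤ (s + 1) * |x| ^ s * |x - y| := by linarith

theorem add_rpow_le_two_rpow_mul (hs : 0 ≤ s) (ha : 0 ≤ a) (hb : 0 ≤ b) :
    (a + b) ^ s ≤ 2 ^ s * (a ^ s + b ^ s) :=
  calc (a + b) ^ s ≤ (2 * max a b) ^ s := by
        gcongr
        linarith [le_max_left a b, le_max_right a b]
    _ = 2 ^ s * max a b ^ s := Real.mul_rpow zero_le_two (ha.trans (le_max_left a b))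
    _ ≤ 2 ^ s * (a ^ s + b ^ s) := by
        gcongr
        rcases max_choice a b with h | h <;> rw [h] <;>
          linarith [Real.rpow_nonneg ha s, Real.rpow_nonneg hb s]

theorem abs_add_rpow_le (hq : 2 ≤ q) :
    |a + b| ^ q ≤ |a| ^ q + q * (a * |a| ^ (q - 2) * b)
      + q * (q - 1) * 2 ^ (q - 2) * (|a| ^ (q - 2) * b ^ 2 + |b| ^ q) := by
  have tangent := abs_rpow_add_mul_sub_le_abs_rpow (q := q) (x := a + b) (y := a) (by linarith)
  have slope_sub_le : ((a + b) * |a + b| ^ (q - 2) - a * |a| ^ (q - 2)) * b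
      ≤ (q - 1) * 2 ^ (q - 2) * (|a| ^ (q - 2) * b ^ 2 + |b| ^ q) := by
    have lipschitz := abs_mul_abs_rpow_sub_mul_abs_rpow_le (s := q - 2) (x := a + b) (y := a)
      (by linarith)
    have max_le : max |a + b| |a| ≤ |a| + |b| :=
      max_le (abs_add_le a b) (le_add_of_nonneg_right (abs_nonneg b))
    have pow_eq : |b| ^ q = |b| ^ (q - 2) * b ^ 2 := by
      rw [← sq_abs b, ← Real.rpow_two, ← Real.rpow_add' (abs_nonneg b) (by linarith),
        sub_add_cancel]
    rw [show q - 2 + 1 = q - 1 by ring, add_sub_cancel_left] at lipschitz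
    calc _ ≤ |(a + b) * |a + b| ^ (q - 2) - a * |a| ^ (q - 2)| * |b| := by
          rw [← abs_mul]; exact le_abs_self _
      _ ≤ (q - 1) * max |a + b| |a| ^ (q - 2) * |b| * |b| := by gcongr
      _ = (q - 1) * max |a + b| |a| ^ (q - 2) * b ^ 2 := by rw [← sq_abs b]; ring
      _ ≤ (q - 1) * (2 ^ (q - 2) * (|a| ^ (q - 2) + |b| ^ (q - 2))) * b ^ 2 := by
          have : 0 ≤ q - 1 := by linarith
          gcongr
          exact (Real.rpow_le_rpow (by positivity) max_le (by linarith)).trans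
            (add_rpow_le_two_rpow_mul (by linarith) (abs_nonneg a) (abs_nonneg b))
      _ = (q - 1) * 2 ^ (q - 2) * (|a| ^ (q - 2) * b ^ 2 + |b| ^ q) := by
          rw [pow_eq]; ring
  have := mul_le_mul_of_nonneg_left slope_sub_le (by linarith : 0 ≤ q)
  linarith

end PointwiseInequalities

section Moments

theorem memLp_ofReal_iff {Ω : Type*} [MeasurableSpace Ω] {P : Measure Ω} {X : Ω → ℝ} {q : ℝ}
    (hq : 0 < q) (hX : AEStronglyMeasurable X P) :
    MemLp X (ENNReal.ofReal q) P ↔ Integrable (fun ω => |X ω| ^ q) P := by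
  have h := integrable_norm_rpow_iff hX (ENNReal.ofReal_pos.2 hq).ne' ENNReal.ofReal_ne_top
  rw [ENNReal.toReal_ofReal hq.le] at h
  exact h.symm

variable {Ω : Type*} [MeasurableSpace Ω] {P : Measure Ω} [IsProbabilityMeasure P]
  {X Y : Ω → ℝ} {q s : ℝ}

theorem integrable_abs_rpow (hX : MemLp X (ENNReal.ofReal q) P) (hs : 0 ≤ s) (hsq : s ≤ q) :
    Integrable (fun ω => |X ω| ^ s) P := by
  simpa [ENNReal.toReal_ofReal hs] using
    (hX.mono_exponent (ENNReal.ofReal_le_ofReal hsq)).integrable_norm_rpow'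

theorem integral_abs_rpow_le_rpow (hX : MemLp X (ENNReal.ofReal q) P) (hq : 0 < q) (hs : 0 ≤ s)
    (hsq : s ≤ q) : ∫ ω, |X ω| ^ s ∂P ≤ (∫ ω, |X ω| ^ q ∂P) ^ (s / q) := by
  have pow_eq : ∀ ω, (|X ω| ^ q) ^ (s / q) = |X ω| ^ s := fun ω => by
    rw [← Real.rpow_mul (abs_nonneg _), mul_div_cancel₀ _ hq.ne']
  have hexp : 0 ≤ s / q := div_nonneg hs hq.le
  simpa only [pow_eq] using
    (Real.concaveOn_rpow hexp ((div_le_one hq).2 hsq)).le_map_integral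
      (Real.continuous_rpow_const hexp).continuousOn isClosed_Ici
      (.of_forall fun ω => Real.rpow_nonneg (abs_nonneg (X ω)) q)
      (integrable_abs_rpow hX hq.le le_rfl)
      (by simpa only [Function.comp_def, pow_eq] using integrable_abs_rpow hX hs hsq)

theorem integrable_mul_abs_rpow (hX : MemLp X (ENNReal.ofReal q) P) (hs : 0 ≤ s)
    (hsq : s + 1 ≤ q) : Integrable (fun ω => X ω * |X ω| ^ s) P := by
  have hmeas : AEStronglyMeasurable (fun ω => X ω * |X ω| ^ s) P :=
    (hX.aestronglyMeasurable.aemeasurable.mul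
      (hX.aestronglyMeasurable.aemeasurable.abs.pow_const s)).aestronglyMeasurable
  refine (integrable_norm_iff hmeas).1 ((integrable_abs_rpow hX (by linarith) hsq).congr
    (.of_forall fun ω => ?_))
  simp only [Real.norm_eq_abs, abs_mul, abs_of_nonneg (Real.rpow_nonneg (abs_nonneg (X ω)) s)]
  rw [Real.rpow_add_one' (abs_nonneg _) (by linarith), mul_comm]

theorem integral_abs_add_rpow_le (hq : 2 ≤ q) (hX : MemLp X (ENNReal.ofReal q) P)
    (hY : MemLp Y (ENNReal.ofReal q) P) (hXY : IndepFun X Y P) (hY0 : ∫ ω, Y ω ∂P = 0) :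
    ∫ ω, |X ω + Y ω| ^ q ∂P ≤ ∫ ω, |X ω| ^ q ∂P + q * (q - 1) * 2 ^ (q - 2) *
      ((∫ ω, |X ω| ^ (q - 2) ∂P) * (∫ ω, |Y ω| ^ (2 : ℝ) ∂P) + ∫ ω, |Y ω| ^ q ∂P) := by
  simp only [Real.rpow_two, sq_abs]
  have indep_slope : IndepFun (fun ω => X ω * |X ω| ^ (q - 2)) Y P :=
    hXY.comp (φ := fun x => x * |x| ^ (q - 2)) (by fun_prop) measurable_id
  have indep_sq : IndepFun (fun ω => |X ω| ^ (q - 2)) (fun ω => Y ω ^ 2) P :=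
    hXY.comp (φ := fun x => |x| ^ (q - 2)) (ψ := fun y => y ^ 2) (by fun_prop) (by fun_prop)
  have hXq := integrable_abs_rpow hX (by linarith) le_rfl
  have hYq := integrable_abs_rpow hY (by linarith) le_rfl
  have hXpow := integrable_abs_rpow hX (s := q - 2) (by linarith) (by linarith)
  have hYsq : Integrable (fun ω => Y ω ^ 2) P := by
    simpa using integrable_abs_rpow hY zero_le_two hq
  have hslope := integrable_mul_abs_rpow hX (s := q - 2) (by linarith) (by linarith)
  have hslopeY : Integrable (fun ω => X ω * |X ω| ^ (q - 2) * Y ω) P :=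
    indep_slope.integrable_mul hslope (hY.integrable (by simpa using by linarith))
  have hXYsq : Integrable (fun ω => |X ω| ^ (q - 2) * Y ω ^ 2) P :=
    indep_sq.integrable_mul hXpow hYsq
  have slope_zero : ∫ ω, X ω * |X ω| ^ (q - 2) * Y ω ∂P = 0 := by
    rw [indep_slope.integral_fun_mul_eq_mul_integral hslope.aestronglyMeasurable
      hY.aestronglyMeasurable, hY0, mul_zero]
  have hlin : Integrable (fun ω => |X ω| ^ q + q * (X ω * |X ω| ^ (q - 2) * Y ω)) P :=
    hXq.add (hslopeY.const_mul q)
  have hquad : Integrable (fun ω => |X ω| ^ (q - 2) * Y ω ^ 2 + |Y ω| ^ q) P := hXYsq.add hYq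
  calc ∫ ω, |X ω + Y ω| ^ q ∂P
      ≤ ∫ ω, (|X ω| ^ q + q * (X ω * |X ω| ^ (q - 2) * Y ω)
          + q * (q - 1) * 2 ^ (q - 2) * (|X ω| ^ (q - 2) * Y ω ^ 2 + |Y ω| ^ q)) ∂P :=
        integral_mono (integrable_abs_rpow (hX.add hY) (by linarith) le_rfl)
          (hlin.add (hquad.const_mul _)) fun ω => abs_add_rpow_le hq
    _ = _ := by
        rw [integral_add hlin (hquad.const_mul _), integral_add hXq (hslopeY.const_mul q),
          integral_const_mul, integral_const_mul, integral_add hXYsq hYq, slope_zero, mul_zero,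
          add_zero, indep_sq.integral_fun_mul_eq_mul_integral hXpow.aestronglyMeasurable
            hYsq.aestronglyMeasurable]

/-- The constant of the moment inequality `integral_abs_sum_rpow_le` for sums of independent
centered random variables. -/
noncomputable def sumMomentConst (q : ℝ) : ℝ := (q * (q - 1) * 2 ^ (q - 1)) ^ (q / 2)

theorem one_le_mul_two_rpow (hq : 2 ≤ q) : 1 ≤ q * (q - 1) * 2 ^ (q - 1) := by
  have := Real.one_le_rpow one_le_two (by linarith : 0 ≤ q - 1)
  nlinarith [mul_nonneg (by linarith : 0 ≤ q) (by linarith : 0 ≤ q - 2)]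

theorem sumMomentConst_pos (hq : 2 ≤ q) : 0 < sumMomentConst q :=
  Real.rpow_pos_of_pos (zero_lt_one.trans_le (one_le_mul_two_rpow hq)) _

theorem mul_sumMomentConst_rpow_add_one_le (hq : 2 ≤ q) :
    q * (q - 1) * 2 ^ (q - 2) * (sumMomentConst q ^ ((q - 2) / q) + 1) ≤ sumMomentConst q := by
  have hb := one_le_mul_two_rpow hq
  have half : q * (q - 1) * 2 ^ (q - 2) = q * (q - 1) * 2 ^ (q - 1) / 2 := by
    rw [show q - 2 = q - 1 - 1 by ring, Real.rpow_sub_one two_ne_zero]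
    ring
  rw [half, sumMomentConst]
  set b := q * (q - 1) * 2 ^ (q - 1)
  have pow_eq : (b ^ (q / 2)) ^ ((q - 2) / q) = b ^ (q / 2 - 1) := by
    rw [← Real.rpow_mul (by linarith)]
    congr 1
    field_simp
  have one_le : 1 ≤ b ^ (q / 2 - 1) := Real.one_le_rpow hb (by linarith)
  calc b / 2 * ((b ^ (q / 2)) ^ ((q - 2) / q) + 1) ≤ b / 2 * (2 * b ^ (q / 2 - 1)) := by
        rw [pow_eq]
        gcongr
        linarith
    _ = b * b ^ (q / 2 - 1) := by ring
    _ = b ^ (q / 2) := by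
        rw [← Real.rpow_one_add' (by linarith) (by linarith), add_sub_cancel]

theorem rpow_add_rpow_sub_one_le (hs : 1 ≤ s) {k : ℝ} (hk : 0 ≤ k) :
    k ^ s + (k + 1) ^ (s - 1) ≤ (k + 1) ^ s := by
  have split : ∀ x : ℝ, 0 ≤ x → x ^ s = x * x ^ (s - 1) := fun x hx => by
    rw [← Real.rpow_one_add' hx (by linarith), add_sub_cancel]
  rw [split k hk, split (k + 1) (by linarith), add_one_mul]
  gcongr
  linarith

theorem sumMomentConst_mul_card_rpow_succ (hq : 2 ≤ q) {M k : ℝ} (hM : 0 ≤ M) (hk : 0 ≤ k) :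
    sumMomentConst q * M * k ^ (q / 2) + q * (q - 1) * 2 ^ (q - 2) *
        ((sumMomentConst q * M * k ^ (q / 2)) ^ ((q - 2) / q) * M ^ (2 / q) + M)
      ≤ sumMomentConst q * M * (k + 1) ^ (q / 2) := by
  set K := sumMomentConst q
  have hK : 0 < K := sumMomentConst_pos hq
  have hk1 : 1 ≤ (k + 1) ^ (q / 2 - 1) := Real.one_le_rpow (by linarith) (by linarith)
  have exponent_sum : (q - 2) / q + 2 / q = 1 := by
    rw [← add_div, sub_add_cancel, div_self (by linarith)]
  have pow_eq : (K * M * k ^ (q / 2)) ^ ((q - 2) / q) * M ^ (2 / q)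
      = K ^ ((q - 2) / q) * M * k ^ (q / 2 - 1) := by
    rw [Real.mul_rpow (by positivity) (by positivity), Real.mul_rpow hK.le hM,
      ← Real.rpow_mul hk, mul_right_comm, mul_assoc (K ^ _),
      ← Real.rpow_add' hM (by rw [exponent_sum]; exact one_ne_zero), exponent_sum, Real.rpow_one]
    congr 2
    field_simp
  rw [pow_eq]
  calc _ ≤ K * M * k ^ (q / 2) + q * (q - 1) * 2 ^ (q - 2) *
          (K ^ ((q - 2) / q) * M * (k + 1) ^ (q / 2 - 1) + M * (k + 1) ^ (q / 2 - 1)) := by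
        have : 0 ≤ q - 1 := by linarith
        gcongr
        · linarith
        · linarith
        · exact le_mul_of_one_le_right hM hk1
    _ = K * M * k ^ (q / 2) + q * (q - 1) * 2 ^ (q - 2) * (K ^ ((q - 2) / q) + 1) *
          (M * (k + 1) ^ (q / 2 - 1)) := by ring
    _ ≤ K * M * k ^ (q / 2) + K * (M * (k + 1) ^ (q / 2 - 1)) := by
        gcongr
        exact mul_sumMomentConst_rpow_add_one_le hq
    _ = K * M * (k ^ (q / 2) + (k + 1) ^ (q / 2 - 1)) := by ring
    _ ≤ K * M * (k + 1) ^ (q / 2) := by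
        gcongr
        exact rpow_add_rpow_sub_one_le (by linarith) hk

theorem integral_abs_sum_rpow_le {ι : Type*} {Y : ι → Ω → ℝ} {M : ℝ} (hq : 2 ≤ q)
    (hind : iIndepFun Y P) (hY : ∀ i, MemLp (Y i) (ENNReal.ofReal q) P)
    (hY0 : ∀ i, ∫ ω, Y i ω ∂P = 0) (hM : ∀ i, ∫ ω, |Y i ω| ^ q ∂P ≤ M) (T : Finset ι) :
    ∫ ω, |∑ i ∈ T, Y i ω| ^ q ∂P ≤ sumMomentConst q * M * (T.card : ℝ) ^ (q / 2) := by
  classical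
  have hq0 : 0 < q := by linarith
  induction T using Finset.induction with
  | empty => simp [Real.zero_rpow hq0.ne', Real.zero_rpow (div_pos hq0 two_pos).ne']
  | insert i T hi ih =>
    have hM0 : 0 ≤ M := (integral_nonneg fun ω => by positivity).trans (hM i)
    have hsum : MemLp (fun ω => ∑ j ∈ T, Y j ω) (ENNReal.ofReal q) P :=
      memLp_finsetSum T fun j _ => hY j
    have indep : IndepFun (fun ω => ∑ j ∈ T, Y j ω) (Y i) P := by
      simpa only [← Finset.sum_apply] using
        hind.indepFun_finsetSum_of_notMem₀ (fun j => (hY j).aestronglyMeasurable.aemeasurable) hi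
    simp only [Finset.sum_insert hi, add_comm (Y i _), Finset.card_insert_of_notMem hi,
      Nat.cast_succ]
    refine (integral_abs_add_rpow_le hq hsum (hY i) indep (hY0 i)).trans
      (le_trans ?_ (sumMomentConst_mul_card_rpow_succ hq hM0 (Nat.cast_nonneg T.card)))
    have mean_pow_le : ∫ ω, |∑ j ∈ T, Y j ω| ^ (q - 2) ∂P
        ≤ (sumMomentConst q * M * (T.card : ℝ) ^ (q / 2)) ^ ((q - 2) / q) :=
      (integral_abs_rpow_le_rpow hsum hq0 (by linarith) (by linarith)).trans
        (Real.rpow_le_rpow (integral_nonneg fun ω => by positivity) ih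
          (div_nonneg (by linarith) hq0.le))
    have mean_sq_le : ∫ ω, |Y i ω| ^ (2 : ℝ) ∂P ≤ M ^ (2 / q) :=
      (integral_abs_rpow_le_rpow (hY i) hq0 zero_le_two hq).trans
        (Real.rpow_le_rpow (integral_nonneg fun ω => by positivity) (hM i) (by positivity))
    have hK := (sumMomentConst_pos hq).le
    have : 0 ≤ q - 1 := by linarith
    gcongr
    exact hM i

theorem integral_abs_add_const_rpow_le (hq : 1 ≤ q) (hX : MemLp X (ENNReal.ofReal q) P) (c : ℝ) :
    ∫ ω, |X ω + c| ^ q ∂P ≤ 2 ^ q * (∫ ω, |X ω| ^ q ∂P + |c| ^ q) := by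
  have hq0 : 0 ≤ q := by linarith
  have hXq := integrable_abs_rpow hX hq0 le_rfl
  calc ∫ ω, |X ω + c| ^ q ∂P ≤ ∫ ω, 2 ^ q * (|X ω| ^ q + |c| ^ q) ∂P :=
        integral_mono_of_nonneg (.of_forall fun ω => by positivity)
          ((hXq.add (integrable_const _)).const_mul _) (.of_forall fun ω =>
            (Real.rpow_le_rpow (abs_nonneg _) (abs_add_le _ _) hq0).trans
              (add_rpow_le_two_rpow_mul hq0 (abs_nonneg _) (abs_nonneg _)))
    _ = 2 ^ q * (∫ ω, |X ω| ^ q ∂P + |c| ^ q) := by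
        rw [integral_const_mul, integral_add hXq (integrable_const _), integral_const]
        simp

theorem integral_abs_sub_integral_rpow_le (hq : 1 ≤ q) (hX : MemLp X (ENNReal.ofReal q) P) :
    ∫ ω, |X ω - ∫ ω', X ω' ∂P| ^ q ∂P ≤ 2 ^ (q + 1) * ∫ ω, |X ω| ^ q ∂P := by
  have hq0 : 0 < q := by linarith
  have mean_le : |-∫ ω, X ω ∂P| ^ q ≤ ∫ ω, |X ω| ^ q ∂P := by
    have h := abs_integral_le_integral_abs.trans
      (by simpa using integral_abs_rpow_le_rpow hX hq0 zero_le_one hq)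
    calc |-∫ ω, X ω ∂P| ^ q ≤ ((∫ ω, |X ω| ^ q ∂P) ^ (1 / q)) ^ q :=
          Real.rpow_le_rpow (abs_nonneg _) (by simpa using h) hq0.le
      _ = ∫ ω, |X ω| ^ q ∂P := by
          rw [← Real.rpow_mul (integral_nonneg fun ω => by positivity),
            one_div_mul_cancel hq0.ne', Real.rpow_one]
  calc ∫ ω, |X ω - ∫ ω', X ω' ∂P| ^ q ∂P
      ≤ 2 ^ q * (∫ ω, |X ω| ^ q ∂P + |-∫ ω, X ω ∂P| ^ q) :=
        integral_abs_add_const_rpow_le hq hX _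
    _ ≤ 2 ^ q * (∫ ω, |X ω| ^ q ∂P + ∫ ω, |X ω| ^ q ∂P) := by gcongr
    _ = 2 ^ (q + 1) * ∫ ω, |X ω| ^ q ∂P := by
        rw [Real.rpow_add_one two_ne_zero]
        ring

theorem rpow_half_div_mul_rpow {k t : ℝ} (hk : 0 < k) (ht : 0 < t) :
    k ^ (q / 2) / (t * k) ^ q = (k * t ^ 2) ^ (-(q / 2)) := by
  rw [Real.rpow_neg (by positivity), div_eq_iff (by positivity), inv_mul_eq_div,
    eq_div_iff (by positivity), ← Real.mul_rpow hk.le (by positivity),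
    show k * (k * t ^ 2) = (t * k) ^ (2 : ℝ) by rw [Real.rpow_two]; ring,
    ← Real.rpow_mul (by positivity), mul_div_cancel₀ _ two_ne_zero]

theorem measure_mul_card_le_abs_sum_sub_integral_le {ι : Type*} [Fintype ι] [Nonempty ι]
    {Y : ι → Ω → ℝ} {M t : ℝ} (hq : 2 ≤ q) (hind : iIndepFun Y P)
    (hY : ∀ i, MemLp (Y i) (ENNReal.ofReal q) P) (hM : ∀ i, ∫ ω, |Y i ω| ^ q ∂P ≤ M)
    (ht : 0 < t) :
    P {ω | t * Fintype.card ι ≤ |∑ i, (Y i ω - ∫ ω', Y i ω' ∂P)|} ≤ ENNReal.ofReal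
      (sumMomentConst q * (2 ^ (q + 1) * M) * (Fintype.card ι * t ^ 2) ^ (-(q / 2))) := by
  have hq0 : 0 < q := by linarith
  have hk : (0 : ℝ) < Fintype.card ι := by exact_mod_cast Fintype.card_pos
  have hcentered : ∀ i, MemLp (fun ω => Y i ω - ∫ ω', Y i ω' ∂P) (ENNReal.ofReal q) P :=
    fun i => (hY i).sub (memLp_const _)
  have mean_zero : ∀ i, ∫ ω, (Y i ω - ∫ ω', Y i ω' ∂P) ∂P = 0 := fun i => by
    rw [integral_sub ((hY i).integrable (by simpa using by linarith)) (integrable_const _)]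
    simp
  have indep : iIndepFun (fun i ω => Y i ω - ∫ ω', Y i ω' ∂P) P :=
    hind.comp (fun i y => y - ∫ ω', Y i ω' ∂P) fun i => by fun_prop
  have moment_le : ∫ ω, |∑ i, (Y i ω - ∫ ω', Y i ω' ∂P)| ^ q ∂P ≤
      sumMomentConst q * (2 ^ (q + 1) * M) * (Fintype.card ι : ℝ) ^ (q / 2) :=
    integral_abs_sum_rpow_le hq indep hcentered mean_zero (fun i =>
      (integral_abs_sub_integral_rpow_le (by linarith) (hY i)).trans (by gcongr; exact hM i))
      Finset.univ
  have subset_pow : {ω | t * Fintype.card ι ≤ |∑ i, (Y i ω - ∫ ω', Y i ω' ∂P)|} ⊆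
      {ω | (t * Fintype.card ι) ^ q ≤ |∑ i, (Y i ω - ∫ ω', Y i ω' ∂P)| ^ q} := fun ω hω =>
    Real.rpow_le_rpow (by positivity) hω hq0.le
  have markov := (mul_meas_ge_le_integral_of_nonneg (.of_forall fun ω => by positivity)
    (integrable_abs_rpow (memLp_finsetSum Finset.univ fun i _ => hcentered i) hq0.le le_rfl)
    ((t * Fintype.card ι) ^ q)).trans moment_le
  refine (measure_mono subset_pow).trans ?_
  rw [← ofReal_measureReal]
  refine ENNReal.ofReal_le_ofReal ?_
  rwa [← rpow_half_div_mul_rpow hk ht, ← mul_div_assoc, le_div_iff₀' (by positivity)]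

theorem measure_mul_card_le_abs_sum_sq_sub_integral_le {ι : Type*} [Fintype ι] [Nonempty ι]
    {X : ι → Ω → ℝ} {M t : ℝ} (hq : 2 ≤ q) (hind : iIndepFun X P)
    (hX : ∀ i, MemLp (X i) (ENNReal.ofReal (2 * q)) P) (hM : ∀ i, ∫ ω, |X i ω| ^ (2 * q) ∂P ≤ M)
    (ht : 0 < t) :
    P {ω | t * Fintype.card ι ≤ |∑ i, (X i ω ^ 2 - ∫ ω', X i ω' ^ 2 ∂P)|} ≤ ENNReal.ofReal
      (sumMomentConst q * (2 ^ (q + 1) * M) * (Fintype.card ι * t ^ 2) ^ (-(q / 2))) := by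
  have pow_eq : ∀ i ω, |X i ω ^ 2| ^ q = |X i ω| ^ (2 * q) := fun i ω => by
    rw [abs_pow, ← Real.rpow_two, ← Real.rpow_mul (abs_nonneg _)]
  refine measure_mul_card_le_abs_sum_sub_integral_le hq
    (hind.comp (fun _ x => x ^ 2) fun _ => by fun_prop) (fun i => ?_) (fun i => ?_) ht
  · refine (memLp_ofReal_iff (by linarith) ((hX i).aestronglyMeasurable.pow 2)).2 ?_
    exact (integrable_abs_rpow (hX i) (by linarith) le_rfl).congr
      (.of_forall fun ω => (pow_eq i ω).symm)
  · simpa only [pow_eq] using hM i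

theorem measure_mul_card_le_abs_sum_mul_sub_integral_le {ι : Type*} [Fintype ι] [Nonempty ι]
    {X Y : ι → Ω → ℝ} {M t : ℝ} (hq : 2 ≤ q) (hind : iIndepFun (fun i ω => (X i ω, Y i ω)) P)
    (hXY : ∀ i, IndepFun (X i) (Y i) P) (hX : ∀ i, MemLp (X i) (ENNReal.ofReal q) P)
    (hY : ∀ i, MemLp (Y i) (ENNReal.ofReal q) P) (hXM : ∀ i, ∫ ω, |X i ω| ^ q ∂P ≤ M)
    (hYM : ∀ i, ∫ ω, |Y i ω| ^ q ∂P ≤ M) (ht : 0 < t) :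
    P {ω | t * Fintype.card ι ≤ |∑ i, (X i ω * Y i ω - ∫ ω', X i ω' * Y i ω' ∂P)|} ≤
      ENNReal.ofReal
        (sumMomentConst q * (2 ^ (q + 1) * M ^ 2) * (Fintype.card ι * t ^ 2) ^ (-(q / 2))) := by
  have hq0 : 0 < q := by linarith
  have indep_pow : ∀ i, IndepFun (fun ω => |X i ω| ^ q) (fun ω => |Y i ω| ^ q) P := fun i =>
    (hXY i).comp (φ := fun x => |x| ^ q) (ψ := fun y => |y| ^ q) (by fun_prop) (by fun_prop)
  have hXq := fun i => integrable_abs_rpow (hX i) hq0.le le_rfl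
  have hYq := fun i => integrable_abs_rpow (hY i) hq0.le le_rfl
  have mul_pow : ∀ i ω, |X i ω * Y i ω| ^ q = |X i ω| ^ q * |Y i ω| ^ q := fun i ω => by
    rw [abs_mul, Real.mul_rpow (abs_nonneg _) (abs_nonneg _)]
  refine measure_mul_card_le_abs_sum_sub_integral_le hq
    (hind.comp (fun _ z => z.1 * z.2) fun _ => by fun_prop) (fun i => ?_) (fun i => ?_) ht
  · refine (memLp_ofReal_iff hq0
      ((hX i).aestronglyMeasurable.mul (hY i).aestronglyMeasurable)).2 ?_
    exact ((indep_pow i).integrable_mul (hXq i) (hYq i)).congr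
      (.of_forall fun ω => (mul_pow i ω).symm)
  · simp only [mul_pow]
    rw [(indep_pow i).integral_fun_mul_eq_mul_integral (hXq i).aestronglyMeasurable
      (hYq i).aestronglyMeasurable, sq]
    have hY0 : 0 ≤ ∫ ω, |Y i ω| ^ q ∂P := integral_nonneg fun ω => by positivity
    exact mul_le_mul (hXM i) (hYM i) hY0 (hY0.trans (hYM i))

theorem iIndepFun_curry {ι κ : Type*} {Z : ι × κ → Ω → ℝ} (hZ : ∀ p, Measurable (Z p))
    (h : iIndepFun Z P) : iIndepFun (fun i ω k => Z (i, k) ω) P := by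
  have : ∀ i k, IsProbabilityMeasure (P.map (Z (i, k))) := fun i k =>
    Measure.isProbabilityMeasure_map (hZ (i, k)).aemeasurable
  have law_row : ∀ i, P.map (fun ω k => Z (i, k) ω) =
      Measure.infinitePi fun k => P.map (Z (i, k)) := fun i =>
    (h.precomp (Prod.mk_right_injective i)).map_fun_eq_infinitePi_map fun k => hZ (i, k)
  rw [iIndepFun_iff_map_fun_eq_infinitePi_map (by fun_prop)]
  simp only [law_row]
  rw [← Measure.infinitePi_map_curry fun i k => P.map (Z (i, k)),
    ← h.map_fun_eq_infinitePi_map hZ, Measure.map_map (by fun_prop) (by fun_prop)]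
  rfl

end Moments

section ConditionalLaws

variable {Ω γ δ : Type*} [MeasurableSpace γ] [StandardBorelSpace γ] [Nonempty γ]
  [MeasurableSpace δ]

theorem lintegral_prodMk_eq_lintegral_condDistrib [MeasurableSpace Ω] {μ : Measure Ω}
    [IsFiniteMeasure μ] {X : Ω → δ} {Y : Ω → γ} (hX : Measurable X) (hY : Measurable Y)
    {f : δ × γ → ℝ≥0∞} (hf : Measurable f) :
    ∫⁻ ω, f (X ω, Y ω) ∂μ = ∫⁻ ω, ∫⁻ y, f (X ω, y) ∂condDistrib Y X μ (X ω) ∂μ := by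
  rw [← lintegral_map hf (hX.prodMk hY), ← compProd_map_condDistrib hY.aemeasurable,
    Measure.lintegral_compProd hf, lintegral_map hf.lintegral_kernel_prod_right' hX]

/-- The regular conditional law of `Z` given the σ-field `F`. In contrast with
`ProbabilityTheory.condExpKernel`, only the space of values of `Z` has to be standard Borel. -/
noncomputable def condLaw (F : MeasurableSpace Ω) [mΩ : MeasurableSpace Ω] (μ : Measure Ω)
    [IsFiniteMeasure μ] (Z : Ω → γ) : Kernel[F] Ω γ :=
  @condDistrib Ω Ω γ _ _ _ mΩ F Z id μ _

variable {F : MeasurableSpace Ω} [mΩ : MeasurableSpace Ω] {μ : Measure Ω} [IsFiniteMeasure μ]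
  {Z : Ω → γ}

instance isMarkovKernel_condLaw : IsMarkovKernel (condLaw F μ Z) :=
  inferInstanceAs (IsMarkovKernel (@condDistrib Ω Ω γ _ _ _ mΩ F Z id μ _))

theorem setLIntegral_eq_setLIntegral_condLaw (hF : F ≤ mΩ) {V : Ω → δ} (hV : Measurable[F] V)
    (hZ : Measurable Z) {f : δ × γ → ℝ≥0∞} (hf : Measurable f) {G : Set Ω}
    (hG : MeasurableSet[F] G) :
    ∫⁻ ω in G, f (V ω, Z ω) ∂μ = ∫⁻ ω in G, ∫⁻ z, f (V ω, z) ∂condLaw F μ Z ω ∂μ := by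
  have hind : @Measurable (Ω × γ) ℝ≥0∞ (F.prod _) _ fun q => G.indicator 1 q.1 * f (V q.1, q.2) :=
    ((@measurable_one ℝ≥0∞ Ω _ F _).indicator hG |>.comp (@measurable_fst Ω γ F _)).mul
      (hf.comp ((hV.comp (@measurable_fst Ω γ F _)).prodMk (@measurable_snd Ω γ F _)))
  have h := @lintegral_prodMk_eq_lintegral_condDistrib Ω γ Ω _ _ _ F mΩ μ _ id Z
    (measurable_id'' hF) hZ _ hind
  have hpull (ω : Ω) : ∫⁻ z, G.indicator 1 ω * f (V ω, z) ∂condLaw F μ Z ω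
      = G.indicator 1 ω * ∫⁻ z, f (V ω, z) ∂condLaw F μ Z ω :=
    lintegral_const_mul _ (hf.comp measurable_prodMk_left)
  have hmul (g : Ω → ℝ≥0∞) : ∫⁻ ω in G, g ω ∂μ = ∫⁻ ω, G.indicator 1 ω * g ω ∂μ := by
    rw [← lintegral_indicator (hF _ hG)]
    simp only [← Set.indicator_mul_left, Pi.one_apply, one_mul]
  rw [hmul, hmul]
  exact h.trans (lintegral_congr hpull)

theorem condLExp_ae_eq_lintegral_condLaw (hF : F ≤ mΩ) (hZ : Measurable Z) {g : γ → ℝ≥0∞}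
    (hg : Measurable g) :
    condLExp F μ (fun ω => g (Z ω)) =ᵐ[μ] fun ω => ∫⁻ z, g z ∂condLaw F μ Z ω :=
  (ae_eq_condLExp hF μ _ (hg.lintegral_kernel (κ := condLaw F μ Z)) fun _ hs =>
    (setLIntegral_eq_setLIntegral_condLaw hF (V := fun _ => ()) measurable_const hZ
      (hg.comp measurable_snd) hs).symm).symm

theorem condExp_ae_eq_integral_condLaw (hF : F ≤ mΩ) (hZ : Measurable Z) {g : γ → ℝ}
    (hg : Measurable g) (hint : Integrable (fun ω => g (Z ω)) μ) :
    μ[fun ω => g (Z ω) | F] =ᵐ[μ] fun ω => ∫ z, g z ∂condLaw F μ Z ω := by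
  have h := @condExp_ae_eq_integral_condDistrib Ω Ω γ ℝ _ _ _ _ mΩ μ _ id Z F _ _
    (measurable_id'' hF) hZ.aemeasurable g hg.stronglyMeasurable hint
  rwa [MeasurableSpace.comap_id] at h

theorem condExp_preimage_ae_eq_condLaw (hF : F ≤ mΩ) (hZ : Measurable Z) {B : Set γ}
    (hB : MeasurableSet B) :
    μ⟦Z ⁻¹' B | F⟧ =ᵐ[μ] fun ω => (condLaw F μ Z ω).real B := by
  refine (condExp_ae_eq_integral_condLaw hF hZ (measurable_const.indicator hB)
    ((integrable_const (1 : ℝ)).indicator (hZ hB))).trans (.of_forall fun ω => ?_)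
  exact integral_indicator_one hB

theorem measure_inter_le_of_condLaw_le [IsProbabilityMeasure μ] (hF : F ≤ mΩ) {V : Ω → δ}
    (hV : Measurable[F] V) (hZ : Measurable Z) {B : Set (δ × γ)} (hB : MeasurableSet B)
    {G : Set Ω} (hG : MeasurableSet[F] G) {c : ℝ≥0∞}
    (h : ∀ᵐ ω ∂μ, ω ∈ G → condLaw F μ Z ω {z | (V ω, z) ∈ B} ≤ c) :
    μ (G ∩ {ω | (V ω, Z ω) ∈ B}) ≤ c := by
  have hVZ : MeasurableSet {ω | (V ω, Z ω) ∈ B} := ((hV.mono hF le_rfl).prodMk hZ) hB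
  calc μ (G ∩ {ω | (V ω, Z ω) ∈ B})
      = ∫⁻ ω in G, B.indicator 1 (V ω, Z ω) ∂μ := by
        rw [Set.inter_comm, ← Measure.restrict_apply hVZ, ← lintegral_indicator_one hVZ]
        rfl
    _ = ∫⁻ ω in G, ∫⁻ z, B.indicator 1 (V ω, z) ∂condLaw F μ Z ω ∂μ :=
        setLIntegral_eq_setLIntegral_condLaw hF hV hZ (measurable_one.indicator hB) hG
    _ = ∫⁻ ω in G, condLaw F μ Z ω {z | (V ω, z) ∈ B} ∂μ :=
        lintegral_congr fun ω => lintegral_indicator_one (measurable_prodMk_left hB)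
    _ ≤ ∫⁻ _ in G, c ∂μ :=
        lintegral_mono_ae ((ae_restrict_iff' (hF _ hG)).2 h)
    _ ≤ c := by
        rw [setLIntegral_const]
        exact mul_le_of_le_one_right' prob_le_one

end ConditionalLaws

section ConditionalIndependence

variable {Ω ι : Type*}

-- These conditions are countably many, so a conditional law satisfies all of them almost surely.
theorem iIndepFun_of_measure_iInter_Iic_rat [MeasurableSpace Ω] {P : Measure Ω}
    [IsProbabilityMeasure P] {X : ι → Ω → ℝ} (hX : ∀ i, Measurable (X i))
    (h : ∀ (s : Finset ι) (a : ι → ℚ), P (⋂ i ∈ s, X i ⁻¹' Set.Iic (a i : ℝ))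
      = ∏ i ∈ s, P (X i ⁻¹' Set.Iic (a i : ℝ))) :
    iIndepFun X P := by
  rw [iIndepFun_iff_iIndep]
  refine iIndepSets.iIndep (fun i => (hX i).comap_le)
    (fun i => Set.preimage (X i) '' ⋃ a : ℚ, {Set.Iic (a : ℝ)})
    (fun i => Real.isPiSystem_Iic_rat.comap (X i)) (fun i => ?_) ?_
  · rw [BorelSpace.measurable_eq (α := ℝ), Real.borel_eq_generateFrom_Iic_rat,
      MeasurableSpace.comap_generateFrom]
  · rw [iIndepSets_iff]
    intro s f hf
    have hIic (i : ι) : ∃ a : ℚ, i ∈ s → f i = X i ⁻¹' Set.Iic (a : ℝ) := by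
      by_cases hi : i ∈ s
      · obtain ⟨t, ht, hft⟩ := hf i hi
        obtain ⟨a, rfl⟩ := Set.mem_iUnion.1 ht
        exact ⟨a, fun _ => hft.symm⟩
      · exact ⟨0, fun hi' => absurd hi' hi⟩
    choose a ha using hIic
    rw [Finset.prod_congr rfl fun i hi => by rw [ha i hi], ← h s a]
    exact congrArg P (Set.iInter₂_congr ha)

theorem CondIndepFamily.ae_iIndepFun_condLaw [Finite ι] {F : MeasurableSpace Ω}
    [mΩ : MeasurableSpace Ω] {μ : Measure Ω} [IsFiniteMeasure μ] {Z : ι → Ω → ℝ}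
    (h : CondIndepFamily F μ Z) (hF : F ≤ mΩ) (hZ : ∀ i, Measurable (Z i)) :
    ∀ᵐ ω ∂μ, iIndepFun (fun i (z : ι → ℝ) => z i) (condLaw F μ (fun ω i => Z i ω) ω) := by
  have := Fintype.ofFinite ι
  have hZ' : Measurable fun ω i => Z i ω := measurable_pi_lambda _ hZ
  have hbox (i : ι) (a : ℚ) : MeasurableSet ((fun z : ι → ℝ => z i) ⁻¹' Set.Iic (a : ℝ)) :=
    measurable_pi_apply i measurableSet_Iic
  suffices hfactor : ∀ᵐ ω ∂μ, ∀ (s : Finset ι) (a : ι → ℚ),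
      (condLaw F μ (fun ω i => Z i ω) ω).real (⋂ i ∈ s, (fun z => z i) ⁻¹' Set.Iic (a i : ℝ))
        = ∏ i ∈ s, (condLaw F μ (fun ω i => Z i ω) ω).real ((fun z => z i) ⁻¹' Set.Iic (a i : ℝ)) by
    filter_upwards [hfactor] with ω hω
    refine iIndepFun_of_measure_iInter_Iic_rat measurable_pi_apply fun s a => ?_
    rw [← ENNReal.toReal_eq_toReal_iff' (measure_ne_top _ _)
      (ENNReal.prod_ne_top fun i _ => measure_ne_top _ _), ENNReal.toReal_prod]
    exact hω s a
  simp only [ae_all_iff]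
  intro s a
  have hjoint := condExp_preimage_ae_eq_condLaw (μ := μ) hF hZ'
    (Finset.measurableSet_biInter s fun i _ => hbox i (a i))
  have hmarginal : ∀ᵐ ω ∂μ, ∀ i, _ :=
    ae_all_iff.2 fun i => condExp_preimage_ae_eq_condLaw (μ := μ) hF hZ' (hbox i (a i))
  have hprod := h s (fun i => Set.Iic (a i : ℝ)) fun i _ => measurableSet_Iic
  simp only [Set.preimage_iInter] at hjoint
  filter_upwards [hjoint, hmarginal, hprod] with ω hω hω' hω''
  rw [← hω, ← Finset.prod_congr rfl fun i _ => hω' i]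
  exact hω''.trans (Finset.prod_apply _ _ _)

end ConditionalIndependence

section ConditionalConcentration

section Law

variable {Ω κ : Type*} [MeasurableSpace Ω] {P : Measure Ω} [Fintype κ]
  {q M C t : ℝ}

theorem memLp_and_integral_abs_rpow_le {X : Ω → ℝ} (hq : 0 < q) (hX : AEStronglyMeasurable X P)
    (hM : 0 ≤ M) (h : ∫⁻ ω, ENNReal.ofReal (|X ω| ^ q) ∂P ≤ ENNReal.ofReal M) :
    MemLp X (ENNReal.ofReal q) P ∧ ∫ ω, |X ω| ^ q ∂P ≤ M := by
  have hmeas : AEStronglyMeasurable (fun ω => |X ω| ^ q) P :=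
    (hX.aemeasurable.abs.pow_const q).aestronglyMeasurable
  have hnonneg : ∀ᵐ ω ∂P, 0 ≤ |X ω| ^ q := .of_forall fun ω => by positivity
  refine ⟨(memLp_ofReal_iff hq hX).2 ⟨hmeas, ?_⟩, ?_⟩
  · rw [hasFiniteIntegral_iff_ofReal hnonneg]
    exact h.trans_lt ENNReal.ofReal_lt_top
  · rw [integral_eq_lintegral_of_nonneg_ae hnonneg hmeas]
    exact ENNReal.toReal_le_of_le_ofReal hM h

theorem sum_integral_sq_eq_card_mul [Nonempty κ] {X : κ → Ω → ℝ} {v : ℝ} (hv : 0 ≤ v)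
    (hX : ∀ l, MemLp (X l) 2 P)
    (h : (∑ l, ∫⁻ ω, ENNReal.ofReal (|X l ω| ^ (2 : ℝ)) ∂P) / (Fintype.card κ : ℝ≥0∞)
      = ENNReal.ofReal v) :
    ∑ l, ∫ ω, X l ω ^ 2 ∂P = Fintype.card κ * v := by
  have hcard : (Fintype.card κ : ℝ≥0∞) ≠ 0 := by exact_mod_cast Fintype.card_ne_zero
  rw [eq_comm, ENNReal.eq_div_iff hcard (ENNReal.natCast_ne_top _), eq_comm] at h
  have hterm (l : κ) : ∫⁻ ω, ENNReal.ofReal (|X l ω| ^ (2 : ℝ)) ∂P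
      = ENNReal.ofReal (∫ ω, X l ω ^ 2 ∂P) := by
    rw [ofReal_integral_eq_lintegral_ofReal (hX l).integrable_sq
      (.of_forall fun ω => sq_nonneg _)]
    simp only [Real.rpow_two, sq_abs]
  simp only [hterm] at h
  rw [← ENNReal.ofReal_sum_of_nonneg fun l _ => integral_nonneg fun ω => sq_nonneg _,
    ← ENNReal.ofReal_natCast, ← ENNReal.ofReal_mul (Nat.cast_nonneg _),
    ENNReal.ofReal_eq_ofReal_iff (Finset.sum_nonneg fun l _ => integral_nonneg fun ω => sq_nonneg _)
      (by positivity)] at h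
  exact h

variable [IsProbabilityMeasure P]

theorem integral_add_const_mul_sub_const {X Y : Ω → ℝ} (hX : Integrable X P) (hY : Integrable Y P)
    (hXY : IndepFun X Y P) (hX0 : ∫ ω, X ω ∂P = 0) (hY0 : ∫ ω, Y ω ∂P = 0) (c : ℝ) :
    ∫ ω, (X ω + c) * (Y ω - c) ∂P = -c ^ 2 := by
  have hind : IndepFun (fun ω => X ω + c) (fun ω => Y ω - c) P :=
    hXY.comp (measurable_id.add_const c) (measurable_id.sub_const c)
  rw [hind.integral_fun_mul_eq_mul_integral (hX.aestronglyMeasurable.add_const c)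
    (hY.aestronglyMeasurable.sub aestronglyMeasurable_const),
    integral_add hX (integrable_const c), integral_sub hY (integrable_const c), hX0, hY0]
  simp only [integral_const, probReal_univ, smul_eq_mul, one_mul]
  ring

theorem measure_mul_card_le_abs_sum_add_mul_sub_add_sq_le [Nonempty κ] {X Y : κ → Ω → ℝ}
    {h : κ → ℝ} (hq : 2 ≤ q) (hind : iIndepFun (fun l ω => (X l ω, Y l ω)) P)
    (hXY : ∀ l, IndepFun (X l) (Y l) P) (hX : ∀ l, MemLp (X l) (ENNReal.ofReal q) P)
    (hY : ∀ l, MemLp (Y l) (ENNReal.ofReal q) P) (hXM : ∀ l, ∫ ω, |X l ω| ^ q ∂P ≤ M)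
    (hYM : ∀ l, ∫ ω, |Y l ω| ^ q ∂P ≤ M) (hX0 : ∀ l, ∫ ω, X l ω ∂P = 0)
    (hY0 : ∀ l, ∫ ω, Y l ω ∂P = 0) (hh : ∀ l, |h l| ≤ C) (ht : 0 < t) :
    P {ω | t * Fintype.card κ ≤ |∑ l, ((X l ω + h l) * (Y l ω - h l) + h l ^ 2)|} ≤
      ENNReal.ofReal (sumMomentConst q * (2 ^ (q + 1) * (2 ^ q * (M + C ^ q)) ^ 2)
        * (Fintype.card κ * t ^ 2) ^ (-(q / 2))) := by
  have hq1 : 1 ≤ ENNReal.ofReal q := by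
    rw [ENNReal.one_le_ofReal]
    linarith
  have hmoment {W : Ω → ℝ} (hW : MemLp W (ENNReal.ofReal q) P) (hWM : ∫ ω, |W ω| ^ q ∂P ≤ M)
      {c : ℝ} (hc : |c| ≤ C) : ∫ ω, |W ω + c| ^ q ∂P ≤ 2 ^ q * (M + C ^ q) :=
    (integral_abs_add_const_rpow_le (by linarith) hW c).trans (by gcongr)
  have hind' : iIndepFun (fun l ω => (X l ω + h l, Y l ω - h l)) P :=
    hind.comp (fun l z => (z.1 + h l, z.2 - h l)) fun l => by fun_prop
  have hXY' (l : κ) : IndepFun (fun ω => X l ω + h l) (fun ω => Y l ω - h l) P :=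
    (hXY l).comp (measurable_id.add_const (h l)) (measurable_id.sub_const (h l))
  refine le_trans (le_of_eq ?_) (measure_mul_card_le_abs_sum_mul_sub_integral_le hq hind' hXY'
    (fun l => (hX l).add (memLp_const (h l))) (fun l => (hY l).sub (memLp_const (h l)))
    (fun l => hmoment (hX l) (hXM l) (hh l))
    (fun l => by
      simp only [sub_eq_add_neg]
      exact hmoment (hY l) (hYM l) (by rw [abs_neg]; exact hh l)) ht)
  simp only [integral_add_const_mul_sub_const ((hX _).integrable hq1) ((hY _).integrable hq1)
    (hXY _) (hX0 _) (hY0 _), sub_neg_eq_add]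

end Law

/-- The event that the conditional absolute moments of order `q` of all the `Z p` given `F` are at
most `M`. -/
def condMomentEvent {Ω ι : Type*} (F : MeasurableSpace Ω) [MeasurableSpace Ω] (μ : Measure Ω)
    (Z : ι → Ω → ℝ) (q M : ℝ) : Set Ω :=
  {ω | ∀ i, condLExp F μ (fun ω' => ENNReal.ofReal (|Z i ω'| ^ q)) ω ≤ ENNReal.ofReal M}

variable {Ω : Type*} {F : MeasurableSpace Ω} [mΩ : MeasurableSpace Ω] {μ : Measure Ω}

theorem CondIndepFamily.precomp {ι ι' : Type*} {Z : ι → Ω → ℝ} (h : CondIndepFamily F μ Z)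
    {g : ι' → ι} (hg : g.Injective) : CondIndepFamily F μ fun i => Z (g i) := by
  classical
  intro s B hB
  have hext (i : ι') : Function.extend g B (fun _ => Set.univ) (g i) = B i := hg.extend_apply B _ i
  have hmap := h (s.map ⟨g, hg⟩) (Function.extend g B fun _ => Set.univ) fun j hj => by
    obtain ⟨i, hi, rfl⟩ := Finset.mem_map.1 hj
    exact (hext i).symm ▸ hB i hi
  simpa only [Finset.mem_map, Function.Embedding.coeFn_mk, Set.iInter_exists, Set.biInter_and',
    Set.iInter_iInter_eq_right, Finset.prod_map, hext] using hmap

section Family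

variable {ι : Type*} [Finite ι] {Z : ι → Ω → ℝ} {q M : ℝ}

theorem measurableSet_condMomentEvent : MeasurableSet[F] (condMomentEvent F μ Z q M) := by
  rw [condMomentEvent, Set.ofPred_forall]
  exact MeasurableSet.iInter fun i => measurable_condLExp F μ _ measurableSet_Iic

variable [IsProbabilityMeasure μ]

theorem ae_lintegral_abs_rpow_condLaw_eq (hF : F ≤ mΩ) (hZ : ∀ i, Measurable (Z i)) (s : ℝ) :
    ∀ᵐ ω ∂μ, ∀ i, ∫⁻ z, ENNReal.ofReal (|z i| ^ s) ∂condLaw F μ (fun ω i => Z i ω) ω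
      = condLExp F μ (fun ω' => ENNReal.ofReal (|Z i ω'| ^ s)) ω := by
  have := Fintype.ofFinite ι
  exact ae_all_iff.2 fun i => (condLExp_ae_eq_lintegral_condLaw hF (measurable_pi_lambda _ hZ)
    (g := fun z => ENNReal.ofReal (|z i| ^ s)) (by fun_prop)).symm

theorem ae_memLp_condLaw (hF : F ≤ mΩ) (hZ : ∀ i, Measurable (Z i)) (hq : 0 < q) (hM : 0 ≤ M) :
    ∀ᵐ ω ∂μ, ω ∈ condMomentEvent F μ Z q M → ∀ i,
      MemLp (fun z : ι → ℝ => z i) (ENNReal.ofReal q) (condLaw F μ (fun ω i => Z i ω) ω) ∧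
        ∫ z, |z i| ^ q ∂condLaw F μ (fun ω i => Z i ω) ω ≤ M := by
  filter_upwards [ae_lintegral_abs_rpow_condLaw_eq hF hZ q] with ω hω hmem i
  exact memLp_and_integral_abs_rpow_le hq (measurable_pi_apply i).aestronglyMeasurable hM
    ((hω i).trans_le (hmem i))

theorem ae_integral_condLaw_eq_zero (hF : F ≤ mΩ) (hZ : ∀ i, Measurable (Z i))
    (hint : ∀ i, Integrable (Z i) μ) (hmean : ∀ i, μ[Z i | F] =ᵐ[μ] 0) :
    ∀ᵐ ω ∂μ, ∀ i, ∫ z, z i ∂condLaw F μ (fun ω i => Z i ω) ω = 0 := by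
  have := Fintype.ofFinite ι
  refine ae_all_iff.2 fun i => ?_
  filter_upwards [condExp_ae_eq_integral_condLaw hF (measurable_pi_lambda _ hZ)
    (measurable_pi_apply i) (hint i), hmean i] with ω hω hω0
  exact hω.symm.trans hω0

end Family

section Array

variable [IsProbabilityMeasure μ] {ι κ : Type*} [Finite ι] [Fintype κ] [Nonempty κ]
  {Z : ι × κ → Ω → ℝ} {q M C v t : ℝ}

theorem measure_inter_mul_card_le_abs_sum_sq_sub_le (hF : F ≤ mΩ) (hq : 2 ≤ q) (hM : 0 ≤ M)
    (hZ : ∀ p, Measurable (Z p)) (hind : CondIndepFamily F μ Z) (hv : 0 ≤ v) {i : ι}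
    (hvar : ∀ᵐ ω ∂μ, (∑ l, condLExp F μ (fun ω' => ENNReal.ofReal (|Z (i, l) ω'| ^ (2 : ℝ))) ω)
      / (Fintype.card κ : ℝ≥0∞) = ENNReal.ofReal v) (ht : 0 < t) :
    μ (condMomentEvent F μ Z (2 * q) M ∩
        {ω | t * Fintype.card κ ≤ |∑ l, Z (i, l) ω ^ 2 - Fintype.card κ * v|}) ≤
      ENNReal.ofReal
        (sumMomentConst q * (2 ^ (q + 1) * M) * (Fintype.card κ * t ^ 2) ^ (-(q / 2))) := by
  refine measure_inter_le_of_condLaw_le hF (V := fun _ => ()) measurable_const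
    (measurable_pi_lambda _ hZ)
    (B := {w | t * Fintype.card κ ≤ |∑ l, w.2 (i, l) ^ 2 - Fintype.card κ * v|})
    (measurableSet_le measurable_const (by fun_prop)) measurableSet_condMomentEvent ?_
  filter_upwards [hind.ae_iIndepFun_condLaw hF hZ,
    ae_memLp_condLaw hF hZ (q := 2 * q) (by linarith) hM,
    ae_lintegral_abs_rpow_condLaw_eq hF hZ 2, hvar] with ω hindω hmom hsq hvarω hω
  have hmoment := hmom hω
  have hsum := sum_integral_sq_eq_card_mul (P := condLaw F μ (fun ω p => Z p ω) ω)
    (X := fun l z => z (i, l)) hv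
    (fun l => (hmoment (i, l)).1.mono_exponent
      (by rw [← ENNReal.ofReal_ofNat]; exact ENNReal.ofReal_le_ofReal (by linarith)))
    (by simpa only [hsq] using hvarω)
  simp only [← hsum, ← Finset.sum_sub_distrib]
  exact measure_mul_card_le_abs_sum_sq_sub_integral_le hq
    (hindω.precomp (Prod.mk_right_injective i)) (fun l => (hmoment _).1) (fun l => (hmoment _).2) ht

theorem measure_inter_mul_card_le_abs_sum_add_mul_sub_add_sq_le (hF : F ≤ mΩ) (hq : 2 ≤ q)
    (hM : 0 ≤ M) (hZ : ∀ p, Measurable (Z p)) (hind : CondIndepFamily F μ Z)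
    (hint : ∀ p, Integrable (Z p) μ) (hmean : ∀ p, μ[Z p | F] =ᵐ[μ] 0) {i j : ι} (hij : i ≠ j)
    {h : Ω → κ → ℝ} (hh : Measurable[F] h) (hhC : ∀ᵐ ω ∂μ, ∀ l, |h ω l| ≤ C) (ht : 0 < t) :
    μ (condMomentEvent F μ Z q M ∩ {ω | t * Fintype.card κ ≤
        |∑ l, ((Z (i, l) ω + h ω l) * (Z (j, l) ω - h ω l) + h ω l ^ 2)|}) ≤
      ENNReal.ofReal (sumMomentConst q * (2 ^ (q + 1) * (2 ^ q * (M + C ^ q)) ^ 2)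
        * (Fintype.card κ * t ^ 2) ^ (-(q / 2))) := by
  refine measure_inter_le_of_condLaw_le hF hh (measurable_pi_lambda _ hZ)
    (B := {w | t * Fintype.card κ ≤
      |∑ l, ((w.2 (i, l) + w.1 l) * (w.2 (j, l) - w.1 l) + w.1 l ^ 2)|})
    (measurableSet_le measurable_const (by fun_prop)) measurableSet_condMomentEvent ?_
  filter_upwards [hind.ae_iIndepFun_condLaw hF hZ, ae_memLp_condLaw hF hZ (q := q) (by linarith) hM,
    ae_integral_condLaw_eq_zero hF hZ hint hmean, hhC] with ω hindω hmom hmeanω hhω hω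
  have hmoment := hmom hω
  have hpairs : iIndepFun (fun l (z : ι × κ → ℝ) => (z (i, l), z (j, l)))
      (condLaw F μ (fun ω p => Z p ω) ω) :=
    (iIndepFun_curry (Z := fun (p : κ × ι) (z : ι × κ → ℝ) => z p.swap)
      (fun p => measurable_pi_apply p.swap) (hindω.precomp Prod.swap_injective)).comp
        (fun _ w => (w i, w j)) fun _ => by fun_prop
  exact measure_mul_card_le_abs_sum_add_mul_sub_add_sq_le hq hpairs
    (fun l => hindω.indepFun fun hpair => hij (congrArg Prod.fst hpair))
    (fun l => (hmoment _).1) (fun l => (hmoment _).1) (fun l => (hmoment _).2)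
    (fun l => (hmoment _).2) (fun l => hmeanω _) (fun l => hmeanω _) hhω ht

end Array

end ConditionalConcentration

section Denoising

theorem div_four_mul_card_le_of_mul_card_le_abs_sum_sub {κ : Type*} [Fintype κ] {x y h : κ → ℝ}
    {v t : ℝ} (ht : t * Fintype.card κ ≤
      |∑ l, ((h l + x l - y l) ^ 2 - h l ^ 2) - 2 * (Fintype.card κ * v)|) :
    t / 4 * Fintype.card κ ≤ |∑ l, x l ^ 2 - Fintype.card κ * v| ∨
      t / 4 * Fintype.card κ ≤ |∑ l, y l ^ 2 - Fintype.card κ * v| ∨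
      t / 4 * Fintype.card κ ≤ |∑ l, ((x l + h l) * (y l - h l) + h l ^ 2)| := by
  have hsplit : ∑ l, ((h l + x l - y l) ^ 2 - h l ^ 2) - 2 * (Fintype.card κ * v)
      = (∑ l, x l ^ 2 - Fintype.card κ * v) + (∑ l, y l ^ 2 - Fintype.card κ * v)
        + -2 * ∑ l, ((x l + h l) * (y l - h l) + h l ^ 2) := by
    have hterm (l : κ) : (h l + x l - y l) ^ 2 - h l ^ 2
        = x l ^ 2 + y l ^ 2 + -2 * ((x l + h l) * (y l - h l) + h l ^ 2) := by ring
    simp only [hterm, Finset.sum_add_distrib, ← Finset.mul_sum]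
    ring
  by_contra! hlt
  have htriangle := abs_add_three (∑ l, x l ^ 2 - Fintype.card κ * v)
    (∑ l, y l ^ 2 - Fintype.card κ * v) (-2 * ∑ l, ((x l + h l) * (y l - h l) + h l ^ 2))
  rw [← hsplit, abs_mul, abs_neg, abs_two] at htriangle
  linarith [hlt.1, hlt.2.1, hlt.2.2]

theorem measure_inter_exists_ne_le {Ω ι : Type*} [Fintype ι] [MeasurableSpace Ω] {μ : Measure Ω}
    {G : Set Ω} {E T : ι → ι → Set Ω} {S : ι → Set Ω} {a b : ℝ} (ha : 0 ≤ a) (hb : 0 ≤ b)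
    (hE : ∀ i j, i ≠ j → ∀ ω ∈ E i j, ω ∈ S i ∨ ω ∈ S j ∨ ω ∈ T i j)
    (hS : ∀ i, μ (G ∩ S i) ≤ ENNReal.ofReal a)
    (hT : ∀ i j, i ≠ j → μ (G ∩ T i j) ≤ ENNReal.ofReal b) :
    μ (G ∩ {ω | ∃ i j, i ≠ j ∧ ω ∈ E i j}) ≤
      ENNReal.ofReal (Fintype.card ι * a + Fintype.card ι ^ 2 * b) := by
  classical
  have hcover : G ∩ {ω | ∃ i j, i ≠ j ∧ ω ∈ E i j} ⊆
      (⋃ i ∈ Finset.univ, G ∩ S i) ∪ ⋃ ij ∈ Finset.univ.offDiag, G ∩ T ij.1 ij.2 := by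
    rintro ω ⟨hG, i, j, hij, hω⟩
    rcases hE i j hij ω hω with h | h | h
    · exact .inl (Set.mem_biUnion (Finset.mem_univ i) ⟨hG, h⟩)
    · exact .inl (Set.mem_biUnion (Finset.mem_univ j) ⟨hG, h⟩)
    · exact .inr (Set.mem_biUnion (x := (i, j)) (by simpa using hij) ⟨hG, h⟩)
  have hoffDiag : ((Finset.univ : Finset ι).offDiag.card : ℝ) ≤ Fintype.card ι ^ 2 := by
    rw [Finset.offDiag_card, sq]
    exact_mod_cast Nat.sub_le _ _
  calc μ (G ∩ {ω | ∃ i j, i ≠ j ∧ ω ∈ E i j})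
      ≤ ∑ i, μ (G ∩ S i) + ∑ ij ∈ Finset.univ.offDiag, μ (G ∩ T ij.1 ij.2) :=
        (measure_mono hcover).trans ((measure_union_le _ _).trans
          (add_le_add (measure_biUnion_finset_le _ _) (measure_biUnion_finset_le _ _)))
    _ ≤ ∑ _i : ι, ENNReal.ofReal a + ∑ _ij ∈ (Finset.univ : Finset ι).offDiag, ENNReal.ofReal b :=
        add_le_add (Finset.sum_le_sum fun i _ => hS i)
          (Finset.sum_le_sum fun ij hij => hT _ _ (Finset.mem_offDiag.1 hij).2.2)
    _ = ENNReal.ofReal (Fintype.card ι * a + (Finset.univ : Finset ι).offDiag.card * b) := by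
        rw [Finset.sum_const, Finset.sum_const, Finset.card_univ, ← ENNReal.ofReal_nsmul,
          ← ENNReal.ofReal_nsmul, ← ENNReal.ofReal_add (by positivity) (by positivity),
          nsmul_eq_mul, nsmul_eq_mul]
    _ ≤ _ := by gcongr

/-- The constant of the denoising inequality: that of the sums of squared errors plus that of the
sums of products of shifted errors. -/
noncomputable def denoisingConst (q M C : ℝ) : ℝ :=
  sumMomentConst q * (2 ^ (q + 1) * M) +
    sumMomentConst (2 * q) * (2 ^ (2 * q + 1) * (2 ^ (2 * q) * (M + (2 * C) ^ (2 * q))) ^ 2)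

theorem measure_inter_exists_mul_card_le_abs_sum_sub_le {Ω ι κ : Type*} [Fintype ι] [Fintype κ]
    [Nonempty κ] {F : MeasurableSpace Ω} [mΩ : MeasurableSpace Ω] {μ : Measure Ω}
    [IsProbabilityMeasure μ] {Z H : ι × κ → Ω → ℝ} {q M C v t : ℝ} (hF : F ≤ mΩ) (hq : 2 ≤ q)
    (hM : 0 ≤ M) (hZ : ∀ p, Measurable (Z p)) (hind : CondIndepFamily F μ Z)
    (hint : ∀ p, Integrable (Z p) μ) (hmean : ∀ p, μ[Z p | F] =ᵐ[μ] 0) (hv : 0 ≤ v)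
    (hvar : ∀ i, ∀ᵐ ω ∂μ,
      (∑ l, condLExp F μ (fun ω' => ENNReal.ofReal (|Z (i, l) ω'| ^ (2 : ℝ))) ω)
        / (Fintype.card κ : ℝ≥0∞) = ENNReal.ofReal v)
    (hH : ∀ p, Measurable[F] (H p)) (hHC : ∀ᵐ ω ∂μ, ∀ p, |H p ω| ≤ C) (ht : 0 < t) :
    μ (condMomentEvent F μ Z (2 * q) M ∩ {ω | ∃ i j, i ≠ j ∧ t * Fintype.card κ ≤
        |∑ l, ((H (i, l) ω - H (j, l) ω + Z (i, l) ω - Z (j, l) ω) ^ 2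
          - (H (i, l) ω - H (j, l) ω) ^ 2) - 2 * (Fintype.card κ * v)|}) ≤
      ENNReal.ofReal (denoisingConst q M C *
        (Fintype.card ι * (Fintype.card κ * (t / 4) ^ 2) ^ (-(q / 2))
          + (Fintype.card ι * (Fintype.card κ * (t / 4) ^ 2) ^ (-(q / 2))) ^ 2)) := by
  set w : ℝ := (Fintype.card κ * (t / 4) ^ 2) ^ (-(q / 2)) with hw
  have hw_sq : w ^ 2 = (Fintype.card κ * (t / 4) ^ 2) ^ (-(2 * q / 2)) := by
    rw [hw, ← Real.rpow_natCast, ← Real.rpow_mul (by positivity)]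
    ring_nf
  have hHC' (i j : ι) : ∀ᵐ ω ∂μ, ∀ l, |H (i, l) ω - H (j, l) ω| ≤ 2 * C := by
    filter_upwards [hHC] with ω hω l
    exact (abs_sub _ _).trans ((add_le_add (hω _) (hω _)).trans_eq (two_mul C).symm)
  have hH' (i j : ι) : Measurable[F] fun ω l => H (i, l) ω - H (j, l) ω :=
    @measurable_pi_lambda Ω κ _ F _ _ fun l => (hH (i, l)).fun_sub (hH (j, l))
  obtain ⟨K₁, hK₁, hK₁_def⟩ : ∃ K, 0 ≤ K ∧ sumMomentConst q * (2 ^ (q + 1) * M) = K :=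
    ⟨_, mul_nonneg (sumMomentConst_pos hq).le (by positivity), rfl⟩
  obtain ⟨K₂, hK₂, hK₂_def⟩ : ∃ K, 0 ≤ K ∧ sumMomentConst (2 * q) *
      (2 ^ (2 * q + 1) * (2 ^ (2 * q) * (M + (2 * C) ^ (2 * q))) ^ 2) = K :=
    ⟨_, mul_nonneg (sumMomentConst_pos (by linarith)).le (by positivity), rfl⟩
  have : 0 ≤ w := by positivity
  refine (measure_inter_exists_ne_le (a := K₁ * w) (b := K₂ * w ^ 2) (by positivity)
    (by positivity) (fun i j _ ω h => div_four_mul_card_le_of_mul_card_le_abs_sum_sub h)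
    (fun i => (measure_inter_mul_card_le_abs_sum_sq_sub_le hF hq hM hZ hind hv (hvar i)
      (by positivity)).trans_eq (by rw [hK₁_def]))
    (fun i j hij => (measure_inter_mul_card_le_abs_sum_add_mul_sub_add_sq_le hF (by linarith) hM hZ
      hind hint hmean hij (hH' i j) (hHC' i j) (by positivity)).trans_eq
        (by rw [hK₂_def, hw_sq]))).trans ?_
  rw [denoisingConst, hK₁_def, hK₂_def]
  refine ENNReal.ofReal_le_ofReal ?_
  calc Fintype.card ι * (K₁ * w) + Fintype.card ι ^ 2 * (K₂ * w ^ 2)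
      ≤ Fintype.card ι * (K₁ * w) + Fintype.card ι ^ 2 * (K₂ * w ^ 2)
        + (K₁ * (Fintype.card ι * w) ^ 2 + K₂ * (Fintype.card ι * w)) :=
        le_add_of_nonneg_right (by positivity)
    _ = (K₁ + K₂) * (Fintype.card ι * w + (Fintype.card ι * w) ^ 2) := by ring

end Denoising

section PartialDerivatives

variable {r m : ℕ} {C : ℝ} {A : Set (EuclideanSpace ℝ (Fin r))}
  {f : EuclideanSpace ℝ (Fin r) → ℝ}

/-- All partial derivatives of `f` of order at most `m`, taken within `A`, are bounded by `C`
on `A`. -/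
def PartialsBounded (m : ℕ) (C : ℝ) (A : Set (EuclideanSpace ℝ (Fin r)))
    (f : EuclideanSpace ℝ (Fin r) → ℝ) : Prop :=
  ∀ k ≤ m, ∀ d : Fin k → Fin r, ∀ x ∈ A,
    |iteratedFDerivWithin ℝ k f A x fun s => EuclideanSpace.single (d s) 1| ≤ C

theorem PartialsBounded.mono_order (h : PartialsBounded m C A f) {m' : ℕ} (hm : m' ≤ m) :
    PartialsBounded m' C A f :=
  fun k hk => h k (hk.trans hm)

theorem PartialsBounded.abs_le (h : PartialsBounded m C A f) {x : EuclideanSpace ℝ (Fin r)}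
    (hx : x ∈ A) : |f x| ≤ C := by
  simpa only [iteratedFDerivWithin_zero_apply] using h 0 (Nat.zero_le _) Fin.elim0 x hx

end PartialDerivatives

section WeakRegularities

variable {r : ℕ} {p : ℕ → ℕ} {Ω : ℕ → Type*} [∀ n, MeasurableSpace (Ω n)]
  {μ : ∀ n, Measure (Ω n)} {S : ∀ n, Sample r n (p n) (Ω n)}
  {A : Set (EuclideanSpace ℝ (Fin r))} {m : ℕ} {ν : ℝ}

/-- A weakening of `Regularities` under which Euclidean distances still permit indirect matching.
The latent variables need not be independent, identically distributed or have a density: it is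
enough that they almost surely lie in `A` and are pairwise distinct. Only two derivatives of the
latent functions are controlled. -/
structure WeakRegularities (μ : ∀ n, Measure (Ω n)) (S : ∀ n, Sample r n (p n) (Ω n))
    (A : Set (EuclideanSpace ℝ (Fin r))) : Prop where
  integrable_u : ∀ n i l, Integrable ((S n).u i l) (μ n)
  condMean_u : ∀ n i l, (μ n)[(S n).u i l | (S n).latentField] =ᵐ[μ n] 0
  condIndep_u : ∀ n, CondIndepFamily (S n).latentField (μ n)
    fun q : Fin n × Fin (p n) => (S n).u q.1 q.2
  isBounded : Bornology.IsBounded A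
  convex : Convex ℝ A
  interior_nonempty : (interior A).Nonempty
  ae_α_mem : ∀ n, ∀ᵐ ω ∂μ n, ∀ i, (S n).α i ω ∈ A
  ae_α_injective : ∀ n, ∀ᵐ ω ∂μ n, Function.Injective fun i => (S n).α i ω
  smooth : ∀ n, ∀ᵐ ω ∂μ n, ∀ l, ContDiffOn ℝ 2 ((S n).η l ω) A
  bounded : ∃ C : ℝ, ∀ n, ∀ᵐ ω ∂μ n, ∀ l, PartialsBounded 2 C A ((S n).η l ω)

theorem WeakRegularities.uniqueDiffOn (h : WeakRegularities μ S A) : UniqueDiffOn ℝ A :=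
  uniqueDiffOn_convex h.convex h.interior_nonempty

theorem Regularities.map_α_absolutelyContinuous (h : Regularities μ S A m ν) {n : ℕ} (i : Fin n) :
    (μ n).map ((S n).α i) ≪ volume.restrict A := by
  obtain ⟨c, C, _, hdensity⟩ := h.density_α
  obtain ⟨f, _, _, hf⟩ := hdensity n
  rw [hf i]
  exact withDensity_absolutelyContinuous _ _

theorem Regularities.ae_α_mem (h : Regularities μ S A m ν) {n : ℕ} (i : Fin n) :
    ∀ᵐ ω ∂μ n, (S n).α i ω ∈ A :=
  ae_of_ae_map ((S n).measurable_α i).aemeasurable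
    ((h.map_α_absolutelyContinuous i).ae_le (ae_restrict_mem h.isCompact.measurableSet))

variable [∀ n, IsProbabilityMeasure (μ n)]

theorem Regularities.interior_nonempty (h : Regularities μ S A m ν) : (interior A).Nonempty := by
  by_contra hempty
  have hvol : volume A = 0 := by
    refine measure_mono_null ?_ (h.convex.addHaar_frontier volume)
    rw [frontier, Set.not_nonempty_iff_eq_empty.1 hempty, Set.sdiff_empty]
    exact subset_closure
  have hmap := h.map_α_absolutelyContinuous (n := 1) 0
  rw [Measure.restrict_eq_zero.2 hvol, Measure.absolutelyContinuous_zero_iff,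
    Measure.map_eq_zero_iff ((S 1).measurable_α 0).aemeasurable] at hmap
  exact IsProbabilityMeasure.ne_zero (μ 1) hmap

theorem ae_ne_of_indepFun {Ω E : Type*} [MeasurableSpace Ω] {P : Measure Ω}
    [IsFiniteMeasure P] [MeasurableSpace E] [MeasurableEq E] {X Y : Ω → E} (hX : Measurable X)
    (hY : Measurable Y) (hind : IndepFun X Y P) [NullSingletonClass (P.map Y)] :
    ∀ᵐ ω ∂P, X ω ≠ Y ω := by
  have hdiag : (P.map fun ω => (X ω, Y ω)) (Set.diagonal E) = 0 := by
    rw [(indepFun_iff_map_prod_eq_prod_map_map hX.aemeasurable hY.aemeasurable).1 hind,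
      Measure.prod_apply measurableSet_diagonal]
    refine (lintegral_congr fun x => ?_).trans lintegral_zero
    exact measure_mono_null (fun y hy => (Set.mem_diagonal_iff.1 hy).symm) (measure_singleton x)
  rw [Measure.map_apply (hX.prodMk hY) measurableSet_diagonal] at hdiag
  exact measure_eq_zero_iff_ae_notMem.1 hdiag

theorem Regularities.weakRegularities (h : Regularities μ S A m ν) (hr : 0 < r) (hm : 2 ≤ m) :
    WeakRegularities μ S A where
  integrable_u := h.integrable_u
  condMean_u := h.condMean_u
  condIndep_u := h.condIndep_u
  isBounded := h.isCompact.isBounded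
  convex := h.convex
  interior_nonempty := h.interior_nonempty
  ae_α_mem _ := ae_all_iff.2 h.ae_α_mem
  ae_α_injective n := by
    have : Nonempty (Fin r) := ⟨⟨0, hr⟩⟩
    have hatoms (i : Fin n) : NullSingletonClass ((μ n).map ((S n).α i)) :=
      ⟨fun x => h.map_α_absolutelyContinuous i (measure_singleton x)⟩
    have hne (i j : Fin n) : ∀ᵐ ω ∂μ n, i ≠ j → (S n).α i ω ≠ (S n).α j ω :=
      ae_all_iff.2 fun hij => ae_ne_of_indepFun ((S n).measurable_α i)
        ((S n).measurable_α j) ((h.indep_α n).indepFun hij)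
    filter_upwards [ae_all_iff.2 fun i => ae_all_iff.2 (hne i)] with ω hω i j hij
    by_contra hne
    exact hω i j hne hij
  smooth n := (h.smooth n).mono fun _ hω l => (hω l).of_le (by exact_mod_cast hm)
  bounded := by
    obtain ⟨C, hC⟩ := h.bounded
    exact ⟨C, fun n => (hC n).mono fun _ hω l => PartialsBounded.mono_order (hω l) hm⟩

end WeakRegularities

section SampleDenoising

-- Only the sections `f · x` are measurable, so `f ω (a ω)` is reached as the limit of
-- `f ω (a_k ω)` for simple functions `a_k` with values in `A` that approximate `a`.
theorem exists_measurable_ae_eq_comp {Ω : Type*} {F mΩ : MeasurableSpace Ω} {μ : Measure[mΩ] Ω}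
    {E : Type*} [PseudoEMetricSpace E] [MeasurableSpace E] [OpensMeasurableSpace E]
    [SecondCountableTopology E]
    {f : Ω → E → ℝ} {a : Ω → E} {A : Set E} (hf : ∀ x, Measurable[F] fun ω => f ω x)
    (ha : Measurable[F] a) (hA : A.Nonempty)
    (h : ∀ᵐ ω ∂μ, ContinuousOn (f ω) A ∧ a ω ∈ A) :
    ∃ g : Ω → ℝ, Measurable[F] g ∧ (fun ω => f ω (a ω)) =ᵐ[μ] g := by
  obtain ⟨y₀, hy₀⟩ := hA
  let s : ℕ → SimpleFunc E E := SimpleFunc.approxOn id measurable_id A y₀ hy₀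
  have hs (k : ℕ) : Measurable[F] fun ω => f ω (s k (a ω)) :=
    @SimpleFunc.measurable_bind _ _ _ F _ (@SimpleFunc.comp _ _ _ F _ (s k) a ha)
      (fun x ω => f ω x) hf
  refine ⟨fun ω => limsup (fun k => f ω (s k (a ω))) atTop, Measurable.limsup hs, ?_⟩
  filter_upwards [h] with ω ⟨hcont, hmem⟩
  have hlim : Tendsto (fun k => s k (a ω)) atTop (𝓝[A] (a ω)) :=
    tendsto_nhdsWithin_iff.2 ⟨SimpleFunc.tendsto_approxOn measurable_id hy₀ (subset_closure hmem),
      .of_forall fun k => SimpleFunc.approxOn_mem measurable_id hy₀ k _⟩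
  exact ((hcont _ hmem).tendsto.comp hlim).limsup_eq.symm

theorem exists_le_of_pos_of_le_iSup {ι : Type*} [Finite ι] {f : ι → ℝ} {t : ℝ} (ht : 0 < t)
    (h : t ≤ ⨆ i, f i) : ∃ i, t ≤ f i := by
  have : Nonempty ι := by
    by_contra hempty
    rw [not_nonempty_iff] at hempty
    exact ht.not_ge (h.trans_eq (Real.iSup_of_isEmpty f))
  obtain ⟨i, hi⟩ := exists_eq_ciSup_of_finite (f := f)
  exact ⟨i, h.trans_eq hi.symm⟩

theorem sqDist_eq_sum {ι : Type*} [Fintype ι] (v w : EuclideanSpace ℝ ι) :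
    sqDist v w = (∑ l, (v l - w l) ^ 2) / (Fintype.card ι : ℝ) := by
  rw [sqDist, EuclideanSpace.real_norm_sq_eq]
  rfl

theorem sqDist_nonneg {ι : Type*} [Fintype ι] (v w : EuclideanSpace ℝ ι) : 0 ≤ sqDist v w := by
  rw [sqDist]
  positivity

namespace Sample

variable {r n p : ℕ} {Ω : Type*} [mΩ : MeasurableSpace Ω] (S : Sample r n p Ω)
  {R : Finset (Fin p)}

theorem measurable_α_latentField (i : Fin n) : Measurable[S.latentField] (S.α i) :=
  Measurable.of_comap_le <| le_sup_of_le_left <|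
    le_iSup (fun i => MeasurableSpace.comap (S.α i) inferInstance) i

theorem measurable_η_latentField (l : Fin p) (x : EuclideanSpace ℝ (Fin r)) :
    Measurable[S.latentField] fun ω => S.η l ω x :=
  Measurable.of_comap_le <| le_sup_of_le_right <| le_iSup_of_le l <|
    le_iSup (fun x => MeasurableSpace.comap (fun ω => S.η l ω x) inferInstance) x

theorem sqDist_colX_sub_mul_card (hR : R.Nonempty) (i j : Fin n) (v : ℝ) (ω : Ω) :
    (sqDist (S.colX R i ω) (S.colX R j ω) - sqDist (S.colH R i ω) (S.colH R j ω) - 2 * v) *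
      Fintype.card R = ∑ l : R, ((S.η l ω (S.α i ω) - S.η l ω (S.α j ω) + S.u i l ω
        - S.u j l ω) ^ 2 - (S.η l ω (S.α i ω) - S.η l ω (S.α j ω)) ^ 2)
        - 2 * (Fintype.card R * v) := by
  have := hR.to_subtype
  have hcard : (Fintype.card R : ℝ) ≠ 0 := by exact_mod_cast Fintype.card_ne_zero
  rw [sqDist_eq_sum, sqDist_eq_sum, sub_mul, sub_mul, div_mul_cancel₀ _ hcard,
    div_mul_cancel₀ _ hcard, ← Finset.sum_sub_distrib, mul_assoc, mul_comm v]
  congr 1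
  refine Finset.sum_congr rfl fun l _ => ?_
  simp only [colX, colH]
  ring

variable {μ : Measure Ω}

theorem exists_measurable_ae_eq_η_α {A : Set (EuclideanSpace ℝ (Fin r))} (hA : A.Nonempty)
    (hα : ∀ᵐ ω ∂μ, ∀ i, S.α i ω ∈ A) (hcont : ∀ᵐ ω ∂μ, ∀ l, ContinuousOn (S.η l ω) A) :
    ∃ H : Fin n → Fin p → Ω → ℝ, (∀ i l, Measurable[S.latentField] (H i l)) ∧
      ∀ᵐ ω ∂μ, ∀ i l, S.η l ω (S.α i ω) = H i l ω := by
  have hversion (i : Fin n) (l : Fin p) := exists_measurable_ae_eq_comp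
    (S.measurable_η_latentField l) (S.measurable_α_latentField i) hA
    (by filter_upwards [hcont, hα] with ω hc hmem using ⟨hc l, hmem i⟩)
  choose H hH hHeq using hversion
  exact ⟨H, hH, ae_all_iff.2 fun i => ae_all_iff.2 fun l => hHeq i l⟩

theorem compl_condMomentEvent_subset {q M : ℝ} :
    (condMomentEvent S.latentField μ (fun z : Fin n × R => S.u z.1 z.2) q M)ᶜ ⊆
      {ω | ENNReal.ofReal M ≤ ⨆ i, ⨆ l ∈ R, S.condMoment μ q i l ω} := by
  intro ω hω
  simp only [condMomentEvent, Set.mem_compl_iff, Set.mem_ofPred_eq, not_forall, not_le] at hω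
  obtain ⟨⟨i, l⟩, hil⟩ := hω
  exact hil.le.trans (le_iSup_of_le i (le_iSup₂_of_le l.1 l.2 le_rfl))

theorem measure_le_iSup_abs_sqDist_colX_sub_le [IsProbabilityMeasure μ]
    {A : Set (EuclideanSpace ℝ (Fin r))} {q M C v t : ℝ} (hq : 2 ≤ q) (hM : 0 ≤ M)
    (hint : ∀ i l, Integrable (S.u i l) μ) (hmean : ∀ i l, μ[S.u i l | S.latentField] =ᵐ[μ] 0)
    (hind : CondIndepFamily S.latentField μ fun z : Fin n × Fin p => S.u z.1 z.2)
    (hA : A.Nonempty) (hα : ∀ᵐ ω ∂μ, ∀ i, S.α i ω ∈ A)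
    (hcont : ∀ᵐ ω ∂μ, ∀ l, ContinuousOn (S.η l ω) A)
    (hC : ∀ᵐ ω ∂μ, ∀ l, ∀ x ∈ A, |S.η l ω x| ≤ C) (hR : R.Nonempty) (hv : 0 ≤ v)
    (hvar : ∀ i, ∀ᵐ ω ∂μ,
      (∑ l ∈ R, S.condMoment μ 2 i l ω) / (R.card : ℝ≥0∞) = ENNReal.ofReal v) (ht : 0 < t) :
    μ {ω | t ≤ ⨆ z : {z : Fin n × Fin n // z.1 ≠ z.2},
        |sqDist (S.colX R z.1.1 ω) (S.colX R z.1.2 ω)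
          - sqDist (S.colH R z.1.1 ω) (S.colH R z.1.2 ω) - 2 * v|} ≤
      μ {ω | ENNReal.ofReal M ≤ ⨆ i, ⨆ l ∈ R, S.condMoment μ (2 * q) i l ω} +
        ENNReal.ofReal (denoisingConst q M C * (n * (R.card * (t / 4) ^ 2) ^ (-(q / 2))
          + (n * (R.card * (t / 4) ^ 2) ^ (-(q / 2))) ^ 2)) := by
  have := hR.to_subtype
  obtain ⟨H, hH, hHeq⟩ := S.exists_measurable_ae_eq_η_α hA hα hcont
  have hHC : ∀ᵐ ω ∂μ, ∀ z : Fin n × R, |H z.1 z.2 ω| ≤ C := by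
    filter_upwards [hHeq, hα, hC] with ω hω hmem hbound z
    exact hω z.1 z.2 ▸ hbound _ _ (hmem _)
  have hindR : CondIndepFamily S.latentField μ fun z : Fin n × R => S.u z.1 z.2 :=
    hind.precomp (g := Prod.map id Subtype.val)
      (Function.injective_id.prodMap Subtype.val_injective)
  have hvarR (i : Fin n) : ∀ᵐ ω ∂μ, (∑ l : R, S.condMoment μ 2 i l ω) / (Fintype.card R : ℝ≥0∞)
      = ENNReal.ofReal v := by
    filter_upwards [hvar i] with ω hω
    rwa [Fintype.card_coe, Finset.sum_coe_sort R fun l => S.condMoment μ 2 i l ω]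
  have htail := measure_inter_exists_mul_card_le_abs_sum_sub_le S.latentField_le hq hM
    (Z := fun z : Fin n × R => S.u z.1 z.2) (H := fun z => H z.1 z.2)
    (fun z => S.measurable_u z.1 z.2) hindR (fun z => hint z.1 z.2) (fun z => hmean z.1 z.2) hv
    hvarR (fun z => hH z.1 z.2) hHC ht
  simp only [Fintype.card_coe, Fintype.card_fin] at htail
  refine (measure_mono_ae ?_).trans ((measure_union_le _ _).trans
    (add_le_add (measure_mono S.compl_condMomentEvent_subset) htail))
  filter_upwards [hHeq] with ω hω hmem
  by_cases hG : ω ∈ condMomentEvent S.latentField μ (fun z : Fin n × R => S.u z.1 z.2) (2 * q) M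
  · obtain ⟨⟨⟨i, j⟩, hij⟩, hle⟩ := exists_le_of_pos_of_le_iSup ht hmem
    refine .inr ⟨hG, i, j, hij, ?_⟩
    simp only [← hω, ← Fintype.card_coe R]
    rw [← S.sqDist_colX_sub_mul_card hR, abs_mul, Nat.abs_cast]
    gcongr
  · exact .inl hG

end Sample

end SampleDenoising

section Rates

theorem tendsto_rpow_neg_mul_log_rpow {t : ℝ} (ht : 0 < t) (s : ℝ) :
    Tendsto (fun n : ℕ => (n : ℝ) ^ (-t) * Real.log n ^ s) atTop (𝓝 0) := by
  refine (((isLittleO_log_rpow_rpow_atTop s ht).tendsto_div_nhds_zero).comp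
    tendsto_natCast_atTop_atTop).congr fun n => ?_
  simp only [Function.comp_apply, div_eq_inv_mul, Real.rpow_neg (Nat.cast_nonneg n)]

variable {p : ℕ → ℕ} {ν : ℝ}

theorem eventually_pos_natCast_log (hp : Tendsto p atTop atTop) :
    ∀ᶠ n : ℕ in atTop, 0 < (n : ℝ) ∧ 0 < Real.log n ∧ 0 < (p n : ℝ) := by
  filter_upwards [hp.eventually_gt_atTop 0, eventually_gt_atTop 1] with n hpn hn
  exact ⟨by exact_mod_cast hn.pos, Real.log_pos (by exact_mod_cast hn), by exact_mod_cast hpn⟩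

theorem isBigO_inv_mul_log (hν : ν ≠ 0) (hp : Tendsto p atTop atTop)
    (hrate : (fun n : ℕ => (n : ℝ) ^ (4 / ν) * Real.log n ^ ((ν - 2) / ν) / (p n : ℝ))
      =O[atTop] fun _ => (1 : ℝ)) :
    (fun n : ℕ => ((p n : ℝ) * Real.log n)⁻¹)
      =O[atTop] fun n : ℕ => (n : ℝ) ^ (-(4 / ν)) * Real.log n ^ (2 / ν - 2) := by
  refine (hrate.mul (isBigO_refl (fun n : ℕ => (n : ℝ) ^ (-(4 / ν)) * Real.log n ^ (2 / ν - 2))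
    atTop)).congr' ?_ (.of_forall fun n => one_mul _)
  filter_upwards [eventually_pos_natCast_log hp] with n ⟨hn, hlog, _⟩
  have hn_cancel : (n : ℝ) ^ (4 / ν) * (n : ℝ) ^ (-(4 / ν)) = 1 := by
    rw [← Real.rpow_add hn, add_neg_cancel, Real.rpow_zero]
  have hlog_cancel : Real.log n ^ ((ν - 2) / ν) * Real.log n ^ (2 / ν - 2) = (Real.log n)⁻¹ := by
    rw [← Real.rpow_add hlog, ← Real.rpow_neg_one]
    congr 1
    field_simp
    ring
  calc (n : ℝ) ^ (4 / ν) * Real.log n ^ ((ν - 2) / ν) / p n *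
        ((n : ℝ) ^ (-(4 / ν)) * Real.log n ^ (2 / ν - 2))
      = ((n : ℝ) ^ (4 / ν) * (n : ℝ) ^ (-(4 / ν))) *
        (Real.log n ^ ((ν - 2) / ν) * Real.log n ^ (2 / ν - 2)) / p n := by ring
    _ = ((p n : ℝ) * Real.log n)⁻¹ := by
      rw [hn_cancel, hlog_cancel, one_mul, mul_inv_rev, div_eq_mul_inv]

theorem eventually_pos_log_div_rpow (hp : Tendsto p atTop atTop) :
    ∀ᶠ n : ℕ in atTop, 0 < (Real.log n / (p n : ℝ)) ^ ((1 : ℝ) / 4) := by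
  filter_upwards [eventually_pos_natCast_log hp] with n ⟨_, hlog, hpn⟩
  positivity

theorem tendsto_log_div_rpow (hν : 0 < ν) (hp : Tendsto p atTop atTop)
    (hrate : (fun n : ℕ => (n : ℝ) ^ (4 / ν) * Real.log n ^ ((ν - 2) / ν) / (p n : ℝ))
      =O[atTop] fun _ => (1 : ℝ)) :
    Tendsto (fun n : ℕ => (Real.log n / (p n : ℝ)) ^ ((1 : ℝ) / 4)) atTop (𝓝 0) := by
  have hbound : (fun n : ℕ => Real.log n / (p n : ℝ))
      =O[atTop] fun n : ℕ => (n : ℝ) ^ (-(4 / ν)) * Real.log n ^ (2 / ν) := by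
    refine ((isBigO_inv_mul_log hν.ne' hp hrate).mul
      (isBigO_refl (fun n : ℕ => Real.log n ^ (2 : ℝ)) atTop)).congr' ?_ ?_
    · filter_upwards [eventually_pos_natCast_log hp] with n ⟨_, hlog, _⟩
      rw [Real.rpow_two]
      field_simp
    · filter_upwards [eventually_pos_natCast_log hp] with n ⟨_, hlog, _⟩
      rw [mul_assoc, ← Real.rpow_add hlog, sub_add_cancel]
  have hlim := (hbound.trans_tendsto (tendsto_rpow_neg_mul_log_rpow (by positivity) _)).rpow_const
    (p := (1 : ℝ) / 4) (.inr (by norm_num))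
  rwa [Real.zero_rpow (by norm_num)] at hlim

theorem mul_sq_log_div_rpow {x y : ℝ} (hx : 0 ≤ x) (hy : 0 ≤ y) :
    x * ((y / x) ^ ((1 : ℝ) / 4)) ^ 2 = (x * y) ^ ((1 : ℝ) / 2) := by
  rcases hx.eq_or_lt with rfl | hx
  · rw [zero_mul, zero_mul, Real.zero_rpow (by norm_num)]
  rw [← Real.rpow_natCast, ← Real.rpow_mul (by positivity),
    show (1 : ℝ) / 4 * (2 : ℕ) = 1 / 2 by norm_num, ← Real.sqrt_eq_rpow, ← Real.sqrt_eq_rpow,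
    show x * y = x ^ 2 * (y / x) by field_simp, Real.sqrt_mul (by positivity),
    Real.sqrt_sq hx.le]

theorem tendsto_mul_mul_sq_rpow (hν : 0 < ν) (hp : Tendsto p atTop atTop)
    (hrate : (fun n : ℕ => (n : ℝ) ^ (4 / ν) * Real.log n ^ ((ν - 2) / ν) / (p n : ℝ))
      =O[atTop] fun _ => (1 : ℝ))
    {D : ℕ → ℝ} (hD : (fun n => (p n : ℝ)) =O[atTop] D) (hD0 : ∀ n, 0 ≤ D n) :
    Tendsto (fun n : ℕ => (n : ℝ) * (D n * ((Real.log n / (p n : ℝ)) ^ ((1 : ℝ) / 4)) ^ 2)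
      ^ (-((2 + ν) / 2))) atTop (𝓝 0) := by
  set a : ℕ → ℝ := fun n => (Real.log n / (p n : ℝ)) ^ ((1 : ℝ) / 4)
  have hroot : (fun n => (D n * a n ^ 2)⁻¹)
      =O[atTop] fun n => ((p n : ℝ) * Real.log n)⁻¹ ^ ((1 : ℝ) / 2) := by
    refine ((hD.mul (isBigO_refl (fun n => a n ^ 2) atTop)).inv_rev ?_).congr_right fun n => ?_
    · filter_upwards [eventually_pos_natCast_log hp, eventually_pos_log_div_rpow hp]
        with n ⟨_, _, hpn⟩ _ hzero
      exact absurd hzero (by positivity)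
    · rw [mul_sq_log_div_rpow (Nat.cast_nonneg _) (Real.log_natCast_nonneg n),
        Real.inv_rpow (by have := Real.log_natCast_nonneg n; positivity)]
  have hbound := (hroot.trans ((isBigO_inv_mul_log hν.ne' hp hrate).rpow (by norm_num)
    (.of_forall fun n => by have := Real.log_natCast_nonneg n; positivity))).rpow
    (r := (2 + ν) / 2) (by positivity)
    (.of_forall fun n => by have := Real.log_natCast_nonneg n; positivity)
  refine (((isBigO_refl (fun n : ℕ => (n : ℝ)) atTop).mul hbound).congr'
    (f₂ := fun n => n * (D n * a n ^ 2) ^ (-((2 + ν) / 2)))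
    (g₂ := fun n => (n : ℝ) ^ (-(2 / ν)) * Real.log n ^ ((2 / ν - 2) * ((2 + ν) / 4)))
    (.of_forall fun n => ?_) ?_).trans_tendsto (tendsto_rpow_neg_mul_log_rpow (by positivity) _)
  · have := hD0 n
    simp only [Real.rpow_neg (show 0 ≤ D n * a n ^ 2 by positivity),
      Real.inv_rpow (show 0 ≤ D n * a n ^ 2 by positivity)]
  · filter_upwards [eventually_pos_natCast_log hp] with n ⟨hn, hlog, _⟩
    have hexp : 1 + -(4 / ν) * (1 / 2 * ((2 + ν) / 2)) = -(2 / ν) := by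
      field_simp
      ring
    rw [← Real.rpow_mul (by positivity), Real.mul_rpow (by positivity) (by positivity),
      ← Real.rpow_mul hn.le, ← Real.rpow_mul hlog.le, ← mul_assoc, ← hexp,
      Real.rpow_add hn, Real.rpow_one, show (1 : ℝ) / 2 * ((2 + ν) / 2) = (2 + ν) / 4 by ring]

end Rates

section Stochastic

variable {Ω : ℕ → Type*} [∀ n, MeasurableSpace (Ω n)] {μ : ∀ n, Measure (Ω n)}

theorem bigOP_of_forall {Y b : ∀ n, Ω n → ℝ}
    (h : ∀ δ : ℝ≥0∞, 0 < δ → ∃ ε₀ : ℝ, ∀ ε ≥ ε₀, ∀ᶠ n in atTop,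
      μ n {ω | ε * |b n ω| ≤ |Y n ω|} ≤ δ) : BigOP μ Y b := by
  refine le_antisymm (le_of_forall_gt_imp_ge_of_dense fun δ hδ => ?_) bot_le
  obtain ⟨ε₀, hε₀⟩ := h δ hδ
  refine limsup_le_of_le (by isBoundedDefault) ?_
  filter_upwards [eventually_ge_atTop ε₀] with ε hε
  exact limsup_le_of_le (by isBoundedDefault) (hε₀ ε hε)

theorem bigOP_of_ae_abs_le {Y : ∀ n, Ω n → ℝ} {K : ℝ} (h : ∀ n, ∀ᵐ ω ∂μ n, |Y n ω| ≤ K) :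
    BigOP μ Y fun _ _ => 1 := by
  refine bigOP_of_forall fun δ _ => ⟨K + 1, fun ε hε => .of_forall fun n => ?_⟩
  refine (measure_eq_zero_iff_ae_notMem.2 ?_).trans_le (zero_le (a := δ))
  filter_upwards [h n] with ω hω hmem
  simp only [abs_one, mul_one] at hmem
  linarith

theorem bigOP_one_of_forall {Y : ∀ n, Ω n → ℝ}
    (h : ∀ δ : ℝ≥0∞, 0 < δ → ∃ κ > 0, ∀ᶠ n in atTop, μ n {ω | Y n ω < κ} ≤ δ) :
    BigOP μ (fun _ _ => 1) Y := by
  refine bigOP_of_forall fun δ hδ => ?_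
  obtain ⟨κ, hκ, hlt⟩ := h δ hδ
  refine ⟨2 / κ, fun ε hε => hlt.mono fun n hn => (measure_mono fun ω hω => ?_).trans hn⟩
  simp only [Set.mem_ofPred_eq, abs_one] at hω ⊢
  by_contra! hle
  have : 0 < |Y n ω| := hκ.trans_le (hle.trans (le_abs_self _))
  have htwo : 2 ≤ ε * |Y n ω| := calc
    2 = 2 / κ * κ := (div_mul_cancel₀ _ hκ.ne').symm
    _ ≤ ε * |Y n ω| := by
      gcongr
      · exact (div_nonneg zero_le_two hκ.le).trans hε
      · exact hle.trans (le_abs_self _)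
  linarith

theorem StochBounded.exists_eventually_le {Y : ∀ n, Ω n → ℝ≥0∞} (h : StochBounded μ Y)
    {δ : ℝ≥0∞} (hδ : 0 < δ) :
    ∃ M : ℝ, 0 ≤ M ∧ ∀ᶠ n in atTop, μ n {ω | ENNReal.ofReal M ≤ Y n ω} ≤ δ := by
  obtain ⟨M, hM, hM0⟩ :=
    ((eventually_lt_of_limsup_lt (h.trans_lt hδ)).and (eventually_ge_atTop 0)).exists
  exact ⟨M, hM0, (eventually_lt_of_limsup_lt hM).mono fun _ hn => hn.le⟩

end Stochastic

section StochasticDenoising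

variable {r : ℕ} {p : ℕ → ℕ} {Ω : ℕ → Type*} [∀ n, MeasurableSpace (Ω n)]
  {μ : ∀ n, Measure (Ω n)} [∀ n, IsProbabilityMeasure (μ n)]
  {S : ∀ n, Sample r n (p n) (Ω n)} {R : ∀ n, Finset (Fin (p n))}
  {A : Set (EuclideanSpace ℝ (Fin r))}

theorem WeakRegularities.bigOP_denoising (h : WeakRegularities μ S A) {q v : ℝ} {a : ℕ → ℝ}
    (hq : 2 ≤ q) (hv : 0 ≤ v) (hR : ∀ᶠ n in atTop, (R n).Nonempty)
    (hvar : ∀ n, ∀ i : Fin n, ∀ᵐ ω ∂μ n,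
      (∑ l ∈ R n, (S n).condMoment (μ n) 2 i l ω) / ((R n).card : ℝ≥0∞) = ENNReal.ofReal v)
    (hmom : StochBounded μ fun n ω => ⨆ i, ⨆ l ∈ R n, (S n).condMoment (μ n) (2 * q) i l ω)
    (ha : ∀ᶠ n in atTop, 0 < a n)
    (hrate : Tendsto (fun n : ℕ => (n : ℝ) * ((R n).card * a n ^ 2) ^ (-(q / 2))) atTop (𝓝 0)) :
    BigOP μ
      (fun n ω => ⨆ z : {z : Fin n × Fin n // z.1 ≠ z.2},
        |sqDist ((S n).colX (R n) z.1.1 ω) ((S n).colX (R n) z.1.2 ω)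
          - sqDist ((S n).colH (R n) z.1.1 ω) ((S n).colH (R n) z.1.2 ω) - 2 * v|)
      (fun n _ => a n) := by
  obtain ⟨C, hC⟩ := h.bounded
  refine bigOP_of_forall fun δ hδ => ⟨4, fun ε hε => ?_⟩
  have hδ2 : 0 < δ / 2 := ENNReal.half_pos hδ.ne'
  obtain ⟨M, hM, hMle⟩ := hmom.exists_eventually_le hδ2
  have hlim : Tendsto (fun n : ℕ => ENNReal.ofReal (denoisingConst q M C *
      (n * ((R n).card * a n ^ 2) ^ (-(q / 2))
        + (n * ((R n).card * a n ^ 2) ^ (-(q / 2))) ^ 2))) atTop (𝓝 0) := by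
    simpa only [zero_pow two_ne_zero, add_zero, mul_zero, ENNReal.ofReal_zero] using
      ENNReal.tendsto_ofReal ((hrate.add (hrate.pow 2)).const_mul (denoisingConst q M C))
  filter_upwards [hMle, hlim.eventually_le_const hδ2, hR, ha] with n hMn hlimn hRn han
  have htail := (S n).measure_le_iSup_abs_sqDist_colX_sub_le hq hM (h.integrable_u n)
    (h.condMean_u n) (h.condIndep_u n) (h.interior_nonempty.mono interior_subset)
    (h.ae_α_mem n) ((h.smooth n).mono fun _ hω l => (hω l).continuousOn)
    ((hC n).mono fun _ hω l _ hx => (hω l).abs_le hx) hRn hv (hvar n)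
    (show 0 < 4 * a n by positivity)
  rw [mul_div_cancel_left₀ _ four_ne_zero] at htail
  refine (measure_mono fun ω hω => ?_).trans
    (htail.trans ((add_le_add hMn hlimn).trans (ENNReal.add_halves δ).le))
  simp only [Set.mem_ofPred_eq] at hω ⊢
  rw [abs_of_pos han, abs_of_nonneg (Real.iSup_nonneg fun _ => abs_nonneg _)] at hω
  exact (mul_le_mul_of_nonneg_right hε han.le).trans hω

end StochasticDenoising

section Calculus

theorem norm_sub_sub_fderivWithin_apply_le {E F : Type*} [NormedAddCommGroup E] [NormedSpace ℝ E]
    [NormedAddCommGroup F] [NormedSpace ℝ F] {A : Set E} {f : E → F} {K : ℝ} (hA : Convex ℝ A)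
    (hf : DifferentiableOn ℝ f A) (hf' : DifferentiableOn ℝ (fderivWithin ℝ f A) A)
    (hK : ∀ z ∈ A, ‖fderivWithin ℝ (fderivWithin ℝ f A) A z‖ ≤ K) {x y : E} (hx : x ∈ A)
    (hy : y ∈ A) : ‖f y - f x - fderivWithin ℝ f A x (y - x)‖ ≤ K * ‖y - x‖ ^ 2 := by
  have hK0 : 0 ≤ K := (norm_nonneg (fderivWithin ℝ (fderivWithin ℝ f A) A x)).trans (hK x hx)
  have hnear : ∀ z ∈ A ∩ Metric.closedBall x ‖y - x‖,
      ‖fderivWithin ℝ f A z - fderivWithin ℝ f A x‖ ≤ K * ‖y - x‖ := fun z ⟨hz, hzx⟩ =>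
    (hA.norm_image_sub_le_of_norm_fderivWithin_le hf' hK hx hz).trans
      (mul_le_mul_of_nonneg_left (mem_closedBall_iff_norm.1 hzx) hK0)
  rw [pow_two, ← mul_assoc]
  exact (hA.inter (convex_closedBall x _)).norm_image_sub_le_of_norm_hasFDerivWithin_le'
    (fun z hz => (hf z hz.1).hasFDerivWithinAt.mono Set.inter_subset_left) hnear
    ⟨hx, Metric.mem_closedBall_self (norm_nonneg _)⟩ ⟨hy, mem_closedBall_iff_norm.2 le_rfl⟩

variable {r : ℕ}

theorem sum_smul_single (v : EuclideanSpace ℝ (Fin r)) :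
    ∑ k, v k • EuclideanSpace.single k (1 : ℝ) = v := by
  simpa only [EuclideanSpace.basisFun_apply, EuclideanSpace.basisFun_repr] using
    (EuclideanSpace.basisFun (Fin r) ℝ).sum_repr v

theorem opNorm_le_of_apply_single_le {F : Type*} [NormedAddCommGroup F] [NormedSpace ℝ F]
    (T : EuclideanSpace ℝ (Fin r) →L[ℝ] F) {B : ℝ} (hB : 0 ≤ B)
    (h : ∀ k, ‖T (EuclideanSpace.single k 1)‖ ≤ B) : ‖T‖ ≤ r * B := by
  refine T.opNorm_le_bound (by positivity) fun v => ?_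
  calc ‖T v‖ = ‖∑ k, v k • T (EuclideanSpace.single k 1)‖ := by
        rw [← sum_smul_single v, map_sum]
        simp only [map_smul, sum_smul_single]
    _ ≤ ∑ k, ‖v k • T (EuclideanSpace.single k 1)‖ := norm_sum_le _ _
    _ ≤ ∑ _k : Fin r, ‖v‖ * B := by
        gcongr with k
        rw [norm_smul]
        exact mul_le_mul (PiLp.norm_apply_le v k) (h k) (norm_nonneg _) (norm_nonneg _)
    _ = r * B * ‖v‖ := by
        rw [Finset.sum_const, Finset.card_univ, Fintype.card_fin, nsmul_eq_mul]
        ring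

variable {A : Set (EuclideanSpace ℝ (Fin r))} {f : EuclideanSpace ℝ (Fin r) → ℝ} {m : ℕ} {C : ℝ}

theorem PartialsBounded.nonneg (h : PartialsBounded m C A f) (hA : A.Nonempty) : 0 ≤ C :=
  (abs_nonneg _).trans (h.abs_le hA.some_mem)

theorem PartialsBounded.norm_fderivWithin_le (h : PartialsBounded m C A f) (hm : 1 ≤ m)
    (hA : UniqueDiffOn ℝ A) {x : EuclideanSpace ℝ (Fin r)} (hx : x ∈ A) :
    ‖fderivWithin ℝ f A x‖ ≤ r * C := by
  refine opNorm_le_of_apply_single_le _ (h.nonneg ⟨x, hx⟩) fun k => ?_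
  simpa only [iteratedFDerivWithin_one_apply (hA x hx), Real.norm_eq_abs] using
    h 1 hm (fun _ => k) x hx

theorem PartialsBounded.norm_fderivWithin_fderivWithin_le (h : PartialsBounded m C A f)
    (hm : 2 ≤ m) (hA : UniqueDiffOn ℝ A) {x : EuclideanSpace ℝ (Fin r)} (hx : x ∈ A) :
    ‖fderivWithin ℝ (fderivWithin ℝ f A) A x‖ ≤ r * (r * C) := by
  have hC : 0 ≤ C := h.nonneg ⟨x, hx⟩
  refine opNorm_le_of_apply_single_le _ (by positivity) fun k => ?_
  refine opNorm_le_of_apply_single_le _ hC fun l => ?_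
  have hkl := h 2 hm ![k, l] x hx
  rwa [iteratedFDerivWithin_two_apply f hA hx] at hkl

theorem PartialsBounded.abs_sub_le (h : PartialsBounded m C A f) (hm : 1 ≤ m)
    (hA : UniqueDiffOn ℝ A) (hc : Convex ℝ A) (hf : ContDiffOn ℝ 1 f A)
    {x y : EuclideanSpace ℝ (Fin r)} (hx : x ∈ A) (hy : y ∈ A) :
    |f y - f x| ≤ r * C * ‖y - x‖ :=
  hc.norm_image_sub_le_of_norm_fderivWithin_le (hf.differentiableOn one_ne_zero)
    (fun _ hz => h.norm_fderivWithin_le hm hA hz) hx hy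

theorem PartialsBounded.abs_sub_sub_le (h : PartialsBounded m C A f) (hm : 2 ≤ m)
    (hA : UniqueDiffOn ℝ A) (hc : Convex ℝ A) (hf : ContDiffOn ℝ 2 f A)
    {x y : EuclideanSpace ℝ (Fin r)} (hx : x ∈ A) (hy : y ∈ A) :
    |f y - f x - fderivWithin ℝ f A x (y - x)| ≤ r * (r * C) * ‖y - x‖ ^ 2 :=
  norm_sub_sub_fderivWithin_apply_le hc (hf.differentiableOn two_ne_zero)
    ((hf.fderivWithin hA (m := 1) (by norm_num)).differentiableOn one_ne_zero)
    (fun _ hz => h.norm_fderivWithin_fderivWithin_le hm hA hz) hx hy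

end Calculus

section SingularValues

variable {E : Type*} [NormedAddCommGroup E] [InnerProductSpace ℝ E] [FiniteDimensional ℝ E]
  {T : E →ₗ[ℝ] E} {d : ℕ}

theorem mul_norm_sq_le_inner_of_le_eigenvalues (hT : T.IsSymmetric) (hd : Module.finrank ℝ E = d)
    {c : ℝ} (hc : ∀ k, c ≤ hT.eigenvalues hd k) (v : E) : c * ‖v‖ ^ 2 ≤ inner ℝ v (T v) := by
  let b := hT.eigenvectorBasis hd
  have hterm (k : Fin d) : inner ℝ v (b k) * inner ℝ (b k) (T v)
      = hT.eigenvalues hd k * inner ℝ (b k) v ^ 2 := by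
    rw [← hT (b k) v, show T (b k) = hT.eigenvalues hd k • b k from hT.apply_eigenvectorBasis hd k,
      real_inner_smul_left, real_inner_comm v (b k)]
    ring
  calc c * ‖v‖ ^ 2 = ∑ k, c * inner ℝ (b k) v ^ 2 := by
        rw [← b.sum_sq_inner_right v, Finset.mul_sum]
    _ ≤ ∑ k, hT.eigenvalues hd k * inner ℝ (b k) v ^ 2 := by
        gcongr with k
        exact hc k
    _ = inner ℝ v (T v) := by
        rw [← b.sum_inner_mul_inner v (T v)]
        exact Finset.sum_congr rfl fun k _ => (hterm k).symm

theorem singularValues_le_abs_of_hasEigenvalue (hT : T.IsSymmetric)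
    (hd : Module.finrank ℝ E = d) {μ : ℝ} (hμ : Module.End.HasEigenvalue T μ) :
    T.singularValues (d - 1) ≤ |μ| := by
  obtain ⟨x, hx⟩ := hμ.exists_hasEigenvector
  have hadj : LinearMap.adjoint T = T := (LinearMap.isSymmetric_iff_isSelfAdjoint T).1 hT
  have hsq : Module.End.HasEigenvalue (LinearMap.adjoint T ∘ₗ T) (μ ^ 2) := by
    refine Module.End.hasEigenvalue_of_hasEigenvector
      ⟨Module.End.mem_eigenspace_iff.2 ?_, hx.2⟩
    rw [LinearMap.comp_apply, hadj, hx.apply_eq_smul, map_smul, hx.apply_eq_smul, smul_smul,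
      pow_two]
  obtain ⟨i, hi⟩ := T.isSymmetric_adjoint_comp_self.exists_eigenvalues_eq hd hsq
  have hval : T.singularValues i = |μ| := by
    rw [← abs_of_nonneg (T.singularValues_nonneg i), ← sq_eq_sq_iff_abs_eq_abs,
      T.sq_singularValues_fin hd]
    exact_mod_cast hi
  exact hval ▸ T.singularValues_antitone (by omega)

theorem sMin_mul_norm_sq_le_inner {r : ℕ} {M : Matrix (Fin r) (Fin r) ℝ}
    (hM : (Matrix.toEuclideanLin M).IsPositive) (v : EuclideanSpace ℝ (Fin r)) :
    sMin M * ‖v‖ ^ 2 ≤ inner ℝ v (Matrix.toEuclideanLin M v) := by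
  refine mul_norm_sq_le_inner_of_le_eigenvalues hM.isSymmetric finrank_euclideanSpace_fin
    (fun k => ?_) v
  rw [← abs_of_nonneg (hM.nonneg_eigenvalues finrank_euclideanSpace_fin k)]
  exact singularValues_le_abs_of_hasEigenvalue hM.isSymmetric finrank_euclideanSpace_fin
    (hM.isSymmetric.hasEigenvalue_eigenvalues finrank_euclideanSpace_fin k)

theorem toEuclideanLin_transpose_mul_self {m n : Type*} [Fintype m] [Fintype n] [DecidableEq n]
    (J : Matrix m n ℝ) :
    Matrix.toEuclideanLin (J.transpose * J)
      = LinearMap.adjoint (Matrix.toEuclideanLin J) ∘ₗ Matrix.toEuclideanLin J := by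
  classical
  ext v : 1
  rw [LinearMap.comp_apply, ← Matrix.toEuclideanLin_conjTranspose_eq_adjoint,
    Matrix.conjTranspose_eq_transpose_of_trivial]
  simp only [Matrix.toLpLin_apply, Matrix.mulVec_mulVec]

end SingularValues

section SampleGeometry

theorem sqDist_le_sq {ι : Type*} [Fintype ι] {v w : EuclideanSpace ℝ ι} {B : ℝ}
    (h : ∀ l, |v l - w l| ≤ B) : sqDist v w ≤ B ^ 2 := by
  rw [sqDist_eq_sum]
  refine div_le_of_le_mul₀ (by positivity) (sq_nonneg B) ?_
  calc ∑ l, (v l - w l) ^ 2 ≤ ∑ _l : ι, B ^ 2 :=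
        Finset.sum_le_sum fun l _ => sq_le_sq.2 ((h l).trans (le_abs_self B))
    _ = B ^ 2 * Fintype.card ι := by rw [Finset.sum_const, nsmul_eq_mul, mul_comm, Finset.card_univ]

theorem sqDist_le_two_mul_add {ι : Type*} [Fintype ι] (u v w : EuclideanSpace ℝ ι) :
    sqDist u w ≤ 2 * (sqDist u v + sqDist v w) := by
  rw [sqDist, sqDist, sqDist, ← add_div, mul_div_assoc']
  gcongr
  calc ‖u - w‖ ^ 2 ≤ (‖u - v‖ + ‖v - w‖) ^ 2 := by
        gcongr
        exact norm_sub_le_norm_sub_add_norm_sub u v w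
    _ ≤ 2 * (‖u - v‖ ^ 2 + ‖v - w‖ ^ 2) := add_sq_le

namespace Sample

variable {r n p : ℕ} {Ω : Type*} [MeasurableSpace Ω] (S : Sample r n p Ω)
  {A : Set (EuclideanSpace ℝ (Fin r))} (R : Finset (Fin p)) {C : ℝ} {ω : Ω} {i j : Fin n}

theorem sqDist_colH_le (hA : UniqueDiffOn ℝ A) (hc : Convex ℝ A)
    (hf : ∀ l, ContDiffOn ℝ 1 (S.η l ω) A) (hb : ∀ l, PartialsBounded 1 C A (S.η l ω))
    (hi : S.α i ω ∈ A) (hj : S.α j ω ∈ A) :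
    sqDist (S.colH R i ω) (S.colH R j ω) ≤ (r * C) ^ 2 * ‖S.α i ω - S.α j ω‖ ^ 2 := by
  rw [← mul_pow]
  exact sqDist_le_sq fun l => (hb l).abs_sub_le le_rfl hA hc (hf l) hj hi

theorem toEuclideanLin_jacobian_apply (x v : EuclideanSpace ℝ (Fin r)) (l : R) :
    Matrix.toEuclideanLin (S.jacobian A R ω x) v l = fderivWithin ℝ (S.η l ω) A x v := by
  conv_rhs => rw [← sum_smul_single v, map_sum]
  simp only [Matrix.toLpLin_apply, Matrix.mulVec, dotProduct, jacobian, Matrix.of_apply, map_smul,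
    smul_eq_mul, mul_comm]

theorem toEuclideanLin_gram (x : EuclideanSpace ℝ (Fin r)) :
    Matrix.toEuclideanLin (S.gram A R ω x) = (1 / (R.card : ℝ)) •
      (LinearMap.adjoint (Matrix.toEuclideanLin (S.jacobian A R ω x))
        ∘ₗ Matrix.toEuclideanLin (S.jacobian A R ω x)) := by
  rw [gram, map_smul, toEuclideanLin_transpose_mul_self]

theorem isPositive_toEuclideanLin_gram (x : EuclideanSpace ℝ (Fin r)) :
    (Matrix.toEuclideanLin (S.gram A R ω x)).IsPositive := by
  rw [toEuclideanLin_gram]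
  exact (LinearMap.isPositive_adjoint_comp_self _).smul_of_nonneg (by positivity)

theorem inner_gram (x v : EuclideanSpace ℝ (Fin r)) :
    inner ℝ v (Matrix.toEuclideanLin (S.gram A R ω x) v)
      = sqDist (Matrix.toEuclideanLin (S.jacobian A R ω x) v) 0 := by
  rw [toEuclideanLin_gram, LinearMap.smul_apply, LinearMap.comp_apply, inner_smul_right,
    LinearMap.adjoint_inner_right, real_inner_self_eq_norm_sq, sqDist, sub_zero, Fintype.card_coe,
    one_div_mul_eq_div]

theorem le_sqDist_colH (hA : UniqueDiffOn ℝ A) (hc : Convex ℝ A)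
    (hf : ∀ l, ContDiffOn ℝ 2 (S.η l ω) A) (hb : ∀ l, PartialsBounded 2 C A (S.η l ω))
    (hi : S.α i ω ∈ A) (hj : S.α j ω ∈ A) {c : ℝ} (hs : c ≤ sMin (S.gram A R ω (S.α i ω)))
    (hd : (r * (r * C)) ^ 2 * ‖S.α i ω - S.α j ω‖ ^ 2 ≤ c / 4) :
    c / 4 * ‖S.α i ω - S.α j ω‖ ^ 2 ≤ sqDist (S.colH R i ω) (S.colH R j ω) := by
  rw [norm_sub_rev] at hd ⊢
  let x := S.α i ω
  let d := S.α j ω - x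
  let J := Matrix.toEuclideanLin (S.jacobian A R ω x)
  have hgram : c * ‖d‖ ^ 2 ≤ sqDist (J d) 0 := by
    rw [← S.inner_gram R]
    exact (mul_le_mul_of_nonneg_right hs (sq_nonneg _)).trans
      (sMin_mul_norm_sq_le_inner (S.isPositive_toEuclideanLin_gram R x) d)
  have htaylor : sqDist (J d) (S.colH R j ω - S.colH R i ω) ≤ (r * (r * C) * ‖d‖ ^ 2) ^ 2 := by
    refine sqDist_le_sq fun l => ?_
    rw [abs_sub_comm, S.toEuclideanLin_jacobian_apply R]
    exact (hb l).abs_sub_sub_le le_rfl hA hc (hf l) hi hj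
  have hcol : sqDist (S.colH R j ω - S.colH R i ω) 0 = sqDist (S.colH R i ω) (S.colH R j ω) := by
    rw [sqDist, sqDist, sub_zero, norm_sub_rev]
  have hremainder : (r * (r * C) * ‖d‖ ^ 2) ^ 2 ≤ c / 4 * ‖d‖ ^ 2 := by
    rw [mul_pow, pow_two (‖d‖ ^ 2), ← mul_assoc]
    exact mul_le_mul_of_nonneg_right hd (sq_nonneg _)
  have htriangle := sqDist_le_two_mul_add (J d) (S.colH R j ω - S.colH R i ω) 0
  rw [hcol] at htriangle
  change c / 4 * ‖d‖ ^ 2 ≤ _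
  linarith

theorem min_mul_sq_le_sqDist_colH (hA : UniqueDiffOn ℝ A) (hc : Convex ℝ A)
    (hf : ∀ l, ContDiffOn ℝ 2 (S.η l ω) A) (hb : ∀ l, PartialsBounded 2 C A (S.η l ω))
    (hi : S.α i ω ∈ A) (hj : S.α j ω ∈ A) {c η Δ D : ℝ}
    (hs : c ≤ sMin (S.gram A R ω (S.α i ω))) (hη : (r * (r * C)) ^ 2 * η ^ 2 ≤ c / 4)
    (hfar : η < ‖S.α i ω - S.α j ω‖ → Δ ≤ sqDist (S.colH R i ω) (S.colH R j ω))
    (hΔ : 0 ≤ Δ) (hD : ‖S.α i ω - S.α j ω‖ ≤ D) :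
    min (c / 4) (Δ / D ^ 2) * ‖S.α i ω - S.α j ω‖ ^ 2
      ≤ sqDist (S.colH R i ω) (S.colH R j ω) := by
  rcases lt_or_ge η ‖S.α i ω - S.α j ω‖ with hlt | hle
  · calc min (c / 4) (Δ / D ^ 2) * ‖S.α i ω - S.α j ω‖ ^ 2
        ≤ Δ / D ^ 2 * D ^ 2 := by
          gcongr
          exact min_le_right _ _
      _ ≤ Δ := by
          rw [div_mul_eq_mul_div, mul_div_assoc]
          exact mul_le_of_le_one_right hΔ (div_self_le_one _)
      _ ≤ sqDist (S.colH R i ω) (S.colH R j ω) := hfar hlt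
  · calc min (c / 4) (Δ / D ^ 2) * ‖S.α i ω - S.α j ω‖ ^ 2
        ≤ c / 4 * ‖S.α i ω - S.α j ω‖ ^ 2 := by
          gcongr
          exact min_le_left _ _
      _ ≤ sqDist (S.colH R i ω) (S.colH R j ω) := by
          refine S.le_sqDist_colH R hA hc hf hb hi hj hs (le_trans ?_ hη)
          gcongr

end Sample

end SampleGeometry

section MatchingBounds

variable {r : ℕ} {p : ℕ → ℕ} {Ω : ℕ → Type*} [∀ n, MeasurableSpace (Ω n)]
  {μ : ∀ n, Measure (Ω n)} {S : ∀ n, Sample r n (p n) (Ω n)}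
  {A : Set (EuclideanSpace ℝ (Fin r))}

theorem WeakRegularities.bigOP_sqDist_div (h : WeakRegularities μ S A)
    (R : ∀ n, Finset (Fin (p n))) :
    BigOP μ
      (fun n ω => ⨆ q : {q : Fin n × Fin n // (S n).α q.1 ω ≠ (S n).α q.2 ω},
        sqDist ((S n).colH (R n) q.1.1 ω) ((S n).colH (R n) q.1.2 ω)
          / ‖(S n).α q.1.1 ω - (S n).α q.1.2 ω‖ ^ (2 : ℝ))
      (fun _ _ => 1) := by
  obtain ⟨C, hC⟩ := h.bounded
  refine bigOP_of_ae_abs_le (K := (r * C) ^ 2) fun n => ?_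
  filter_upwards [h.smooth n, hC n, h.ae_α_mem n] with ω hsmooth hbounded hmem
  rw [abs_of_nonneg (Real.iSup_nonneg fun q => div_nonneg (sqDist_nonneg _ _) (by positivity))]
  refine Real.iSup_le (fun q => ?_) (sq_nonneg _)
  rw [Real.rpow_two]
  exact div_le_of_le_mul₀ (sq_nonneg _) (sq_nonneg _) ((S n).sqDist_colH_le (R n) h.uniqueDiffOn
    h.convex (fun l => (hsmooth l).of_le one_le_two)
    (fun l => (hbounded l).mono_order one_le_two) (hmem _) (hmem _))

theorem exists_pos_mul_sq_le (K : ℝ) {c : ℝ} (hc : 0 < c) : ∃ η > 0, K * η ^ 2 ≤ c := by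
  have hlim : Tendsto (fun η : ℝ => K * η ^ 2) (𝓝[>] 0) (𝓝 0) :=
    (Continuous.tendsto' (by fun_prop) 0 0 (by ring)).mono_left nhdsWithin_le_nhds
  obtain ⟨η, hη, hη0⟩ := ((hlim.eventually_le_const hc).and self_mem_nhdsWithin).exists
  exact ⟨η, hη0, hη⟩

theorem WeakRegularities.ae_iInf_sqDist_div_ge (h : WeakRegularities μ S A)
    (R : ∀ n, Finset (Fin (p n))) {c : ℝ} (hc : 0 < c) :
    ∃ η > 0, ∀ Δ > 0, ∃ κ > 0, ∀ n ≥ 2, ∀ᵐ ω ∂μ n,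
      (∀ i j, η < ‖(S n).α i ω - (S n).α j ω‖ →
        Δ ≤ sqDist ((S n).colH (R n) i ω) ((S n).colH (R n) j ω)) →
      (∀ i, c ≤ sMin ((S n).gram A (R n) ω ((S n).α i ω))) →
      κ ≤ ⨅ q : {q : Fin n × Fin n // (S n).α q.1 ω ≠ (S n).α q.2 ω},
        sqDist ((S n).colH (R n) q.1.1 ω) ((S n).colH (R n) q.1.2 ω)
          / ‖(S n).α q.1.1 ω - (S n).α q.1.2 ω‖ ^ (2 : ℝ) := by
  obtain ⟨C, hC⟩ := h.bounded
  obtain ⟨η, hη, hηc⟩ := exists_pos_mul_sq_le ((r * (r * C)) ^ 2) (show 0 < c / 4 by positivity)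
  obtain ⟨D, hD, hAD⟩ := h.isBounded.exists_pos_norm_le
  refine ⟨η, hη, fun Δ hΔ => ⟨min (c / 4) (Δ / (2 * D) ^ 2), by positivity, fun n hn => ?_⟩⟩
  filter_upwards [h.smooth n, hC n, h.ae_α_mem n, h.ae_α_injective n]
    with ω hsmooth hbounded hmem hinj hfar hgram
  have hne : (⟨0, by omega⟩ : Fin n) ≠ ⟨1, by omega⟩ := by simp
  have : Nonempty {q : Fin n × Fin n // (S n).α q.1 ω ≠ (S n).α q.2 ω} :=
    ⟨⟨(_, _), hinj.ne hne⟩⟩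
  refine le_ciInf fun q => ?_
  rw [Real.rpow_two, le_div_iff₀ (pow_pos (norm_pos_iff.2 (sub_ne_zero.2 q.2)) 2)]
  refine (S n).min_mul_sq_le_sqDist_colH (R n) h.uniqueDiffOn h.convex hsmooth hbounded (hmem _)
    (hmem _) (hgram _) hηc (hfar _ _) hΔ.le ?_
  rw [two_mul]
  exact norm_sub_le_of_le (hAD _ (hmem _)) (hAD _ (hmem _))

theorem WeakRegularities.bigOP_one_sqDist_div (h : WeakRegularities μ S A)
    {R : ∀ n, Finset (Fin (p n))}
    (hfar : ∀ ε : ℝ, 0 < ε →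
      Tendsto (fun Δ : ℝ => limsup (fun n : ℕ => μ n {ω | ∃ i j : Fin n,
          sqDist ((S n).colH (R n) i ω) ((S n).colH (R n) j ω) < Δ ∧
          ε < ‖(S n).α i ω - (S n).α j ω‖}) atTop)
        (𝓝[>] 0) (𝓝 0))
    (hgram : ∃ c : ℝ, 0 < c ∧
      Tendsto (fun n : ℕ => μ n {ω | ¬ ∀ i : Fin n,
          c ≤ sMin ((S n).gram A (R n) ω ((S n).α i ω))}) atTop (𝓝 0)) :
    BigOP μ (fun _ _ => 1)
      (fun n ω => ⨅ q : {q : Fin n × Fin n // (S n).α q.1 ω ≠ (S n).α q.2 ω},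
        sqDist ((S n).colH (R n) q.1.1 ω) ((S n).colH (R n) q.1.2 ω)
          / ‖(S n).α q.1.1 ω - (S n).α q.1.2 ω‖ ^ (2 : ℝ)) := by
  obtain ⟨c, hc, hgramlim⟩ := hgram
  obtain ⟨η, hη, hηΔ⟩ := h.ae_iInf_sqDist_div_ge R hc
  refine bigOP_one_of_forall fun δ hδ => ?_
  have hδ2 : 0 < δ / 2 := ENNReal.half_pos hδ.ne'
  obtain ⟨Δ, hΔ, hΔ0⟩ :=
    (((hfar η hη).eventually_lt_const hδ2).and self_mem_nhdsWithin).exists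
  obtain ⟨κ, hκ, hκle⟩ := hηΔ Δ hΔ0
  refine ⟨κ, hκ, ?_⟩
  filter_upwards [eventually_lt_of_limsup_lt hΔ, hgramlim.eventually_le_const hδ2,
    eventually_ge_atTop 2] with n hfarn hgramn hn
  refine (measure_mono_ae ?_).trans ((measure_union_le _ _).trans
    ((add_le_add hfarn.le hgramn).trans (ENNReal.add_halves δ).le))
  filter_upwards [hκle n hn] with ω hω hlt
  by_contra hgood
  have hsep : ∀ i j, η < ‖(S n).α i ω - (S n).α j ω‖ →
      Δ ≤ sqDist ((S n).colH (R n) i ω) ((S n).colH (R n) j ω) :=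
    fun i j hij => not_lt.1 fun hclose => hgood (.inl ⟨i, j, hclose, hij⟩)
  have hgramω : ∀ i, c ≤ sMin ((S n).gram A (R n) ω ((S n).α i ω)) :=
    by_contra fun hneg => hgood (.inr hneg)
  exact (hω hsep hgramω).not_gt hlt

end MatchingBounds

end NonlinearFactor

theorem mainTheorem6_general {r : ℕ} {ν : ℝ} (hν : 0 < ν) (σ : ℝ)
    (A : Set (EuclideanSpace ℝ (Fin r)))
    {Ω : ℕ → Type*} [∀ n, MeasurableSpace (Ω n)]
    (μ : ∀ n, Measure (Ω n)) [∀ n, IsProbabilityMeasure (μ n)]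
    (p : ℕ → ℕ) (hp : Tendsto p atTop atTop)
    (S : ∀ n, NonlinearFactor.Sample r n (p n) (Ω n))
    (R : ∀ n, Finset (Fin (p n)))
    (hR : (fun n => (p n : ℝ)) =O[atTop] fun n => ((R n).card : ℝ))
    (hreg : NonlinearFactor.WeakRegularities μ S A)
    (h_i : ∀ n, ∀ i : Fin n, ∀ᵐ ω ∂μ n,
      (∑ l ∈ R n, (S n).condMoment (μ n) 2 i l ω) / ((R n).card : ℝ≥0∞) = ENNReal.ofReal (σ ^ 2))
    (h_ii : NonlinearFactor.StochBounded μ fun n ω =>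
      ⨆ i, ⨆ l ∈ R n, (S n).condMoment (μ n) (4 + 2 * ν) i l ω)
    (h_iii : ∀ ε : ℝ, 0 < ε →
      Tendsto (fun Δ : ℝ => limsup (fun n : ℕ => μ n {ω | ∃ i j : Fin n,
          NonlinearFactor.sqDist ((S n).colH (R n) i ω) ((S n).colH (R n) j ω) < Δ ∧
          ε < ‖(S n).α i ω - (S n).α j ω‖}) atTop)
        (𝓝[>] 0) (𝓝 0))
    (h_iv : ∃ c : ℝ, 0 < c ∧
      Tendsto (fun n : ℕ => μ n {ω | ¬ ∀ i : Fin n,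
          c ≤ NonlinearFactor.sMin ((S n).gram A (R n) ω ((S n).α i ω))}) atTop (𝓝 0))
    (hrate : (fun n : ℕ => (n : ℝ) ^ (4 / ν) * Real.log n ^ ((ν - 2) / ν) / (p n : ℝ))
      =O[atTop] fun _ => (1 : ℝ)) :
    NonlinearFactor.IndirectMatching μ S R (fun _ => NonlinearFactor.sqDist)
      (2 * σ ^ 2) 2 2 (fun n => (Real.log n / (p n : ℝ)) ^ ((1 : ℝ) / 4)) := by
  have hR_nonempty : ∀ᶠ n in atTop, (R n).Nonempty := by
    filter_upwards [hR.eq_zero_imp, hp.eventually_gt_atTop 0] with n hn hpn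
    rw [← Finset.card_ne_zero]
    exact fun hcard => hpn.ne' (by exact_mod_cast hn (by exact_mod_cast hcard))
  rw [show 4 + 2 * ν = 2 * (2 + ν) by ring] at h_ii
  exact {
    ρ₀_nonneg := by positivity
    ςlo_pos := two_pos
    ςhi_pos := two_pos
    a_pos := NonlinearFactor.eventually_pos_log_div_rpow hp
    a_tendsto := NonlinearFactor.tendsto_log_div_rpow hν hp hrate
    denoising := hreg.bigOP_denoising (by linarith) (sq_nonneg σ) hR_nonempty h_i h_ii
      (NonlinearFactor.eventually_pos_log_div_rpow hp)
      (NonlinearFactor.tendsto_mul_mul_sq_rpow hν hp hrate hR fun _ => Nat.cast_nonneg _)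
    upper := hreg.bigOP_sqDist_div R
    lower := hreg.bigOP_one_sqDist_div h_iii h_iv }

theorem mainTheorem6 {r : ℕ} (hr : 0 < r) {m : ℕ} (hm : 2 ≤ m) {ν : ℝ} (hν : 0 < ν) (σ : ℝ)
    (A : Set (EuclideanSpace ℝ (Fin r)))
    {Ω : ℕ → Type*} [∀ n, MeasurableSpace (Ω n)]
    (μ : ∀ n, Measure (Ω n)) [∀ n, IsProbabilityMeasure (μ n)]
    (p : ℕ → ℕ) (hp : Tendsto p atTop atTop)
    (S : ∀ n, NonlinearFactor.Sample r n (p n) (Ω n))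
    (R : ∀ n, Finset (Fin (p n)))
    (hR : (fun n => ((R n).card : ℝ)) =Θ[atTop] fun n => (p n : ℝ))
    (hRc : (fun n => (((R n)ᶜ).card : ℝ)) =Θ[atTop] fun n => (p n : ℝ))
    (hreg : NonlinearFactor.Regularities μ S A m ν)
    (h_i : ∀ n, ∀ i : Fin n, ∀ᵐ ω ∂μ n,
      (∑ l ∈ R n, (S n).condMoment (μ n) 2 i l ω) / ((R n).card : ℝ≥0∞) = ENNReal.ofReal (σ ^ 2))
    (h_ii : NonlinearFactor.StochBounded μ fun n ω =>
      ⨆ i, ⨆ l ∈ R n, (S n).condMoment (μ n) (4 + 2 * ν) i l ω)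
    (h_iii : ∀ ε : ℝ, 0 < ε →
      Tendsto (fun Δ : ℝ => limsup (fun n : ℕ => μ n {ω | ∃ i j : Fin n,
          NonlinearFactor.sqDist ((S n).colH (R n) i ω) ((S n).colH (R n) j ω) < Δ ∧
          ε < ‖(S n).α i ω - (S n).α j ω‖}) atTop)
        (𝓝[>] 0) (𝓝 0))
    (h_iv : ∃ c : ℝ, 0 < c ∧
      Tendsto (fun n : ℕ => μ n {ω | ¬ ∀ i : Fin n,
          c ≤ NonlinearFactor.sMin ((S n).gram A (R n) ω ((S n).α i ω))}) atTop (𝓝 0))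
    (hrate : (fun n : ℕ => (n : ℝ) ^ (4 / ν) * Real.log n ^ ((ν - 2) / ν) / (p n : ℝ))
      =O[atTop] fun _ => (1 : ℝ)) :
    NonlinearFactor.IndirectMatching μ S R (fun _ => NonlinearFactor.sqDist)
      (2 * σ ^ 2) 2 2 (fun n => (Real.log n / (p n : ℝ)) ^ ((1 : ℝ) / 4)) :=
  mainTheorem6_general hν σ A μ p hp S R hR.2 (hreg.weakRegularities hr hm) h_i h_ii h_iii h_iv
    hrate
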